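/- Let $3\le n\le 7$ and $1\le m\le n-1$. The inequality $m^2-mn+m+n>0$ fails if and only if $6\le n\le 7$ and $2\le m\le n-3$. In each of these cases the manifold $N=\mathbb S^{n-m}\times\mathbb T^{m-1}\times\mathbb R$ carries a complete smooth Riemannian metric with uniformly positive $m$-intermediate curvature (so the condition $m^2-mn+m+n>0$ is sharp for the non-existence of such metrics). More precisely, let $6\le n\le 7$, $2\le m\le n-3$ and $\lambda>0$. If $\frac4{n-m}=\frac{2m-2}m$, put $$u(r)=\exp\Big(\frac{m\lambda r^2}{(2m-2)(n-m-2)}\Big),\qquad f(r)=\exp\Big(-\frac{\lambda r^2}{2(n-m-2)}\Big);$$ otherwise (then $\frac4{n-m}<\frac{2m-2}m$) put $C_3=-\frac2{n-m-2}$, $C_4=\frac{(n-m)-\frac{2m}{m-1}}{(n-m-2)^2}>0$ and $$u(r)=\big(\cosh(\sqrt{C_4\lambda}\,r)\big)^{-\frac{mC_3}{(2m-2)C_4}},\qquad f(r)=\big(\cosh(\sqrt{C_4\lambda}\,r)\big)^{\frac{C_3-1}{(n-m)C_4}}.$$ Then there is $\epsilon_0>0$ such that for every $0<\epsilon<\epsilon_0$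 the formula $$g=dr^2+\epsilon^2f(r)^2g_{\mathbb S}+u(r)^{4/m}\big(dx_1^2+\dots+dx_{m-1}^2\big)$$ defines a complete smooth Riemannian metric on $N$ with $C_m(p)\ge\lambda$ for every $p\in N$. Here $r$ is the coordinate of $\mathbb R$, $g_{\mathbb S}$ is the round metric of the unit sphere $\mathbb S^{n-m}$, $dx_i^2$ is the standard metric of the $i$-th unit circle of $\mathbb T^{m-1}=(\mathbb S^1)^{m-1}$, and the $m$-intermediate curvature at $p$ is $$C_m(p)=\min\Big\{\sum_{a=1}^{m}\sum_{b=a+1}^{n}\mathrm{Rm}(e_a,e_b,e_a,e_b)\;:\;(e_1,\dots,e_n)\text{ an orthonormal basis of }T_pN\Big\},$$ where $\mathrm{Rm}(e_a,e_b,e_a,e_b)$ is the sectional curvature of the plane spanned by $e_a,e_b$; uniformly positive means $C_m\ge\lambda$ on $N$ for some constant $\lambda>0$. -/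

import Mathlib

open scoped Manifold ContDiff Topology

noncomputable section

/-! ### Finite products of manifolds -/

section PiManifold

variable {ι : Type*} [Fintype ι] {E : ι → Type*} [∀ i, NormedAddCommGroup (E i)]
  [∀ i, NormedSpace ℝ (E i)] {H : ι → Type*} [∀ i, TopologicalSpace (H i)]

instance boundaryless_pi (I : ∀ i, ModelWithCorners ℝ (E i) (H i)) [∀ i, (I i).Boundaryless] :
    (ModelWithCorners.pi I).Boundaryless where
  range_eq_univ := by
    refine Set.eq_univ_of_forall fun y => ⟨fun i => (I i).symm (y i), ?_⟩
    funext i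
    have h : y i ∈ Set.range (I i) := by
      rw [ModelWithCorners.Boundaryless.range_eq_univ]; trivial
    exact (I i).right_inv h

/-- A finite product of manifolds without boundary is a manifold. -/
instance isManifold_pi (I : ∀ i, ModelWithCorners ℝ (E i) (H i)) [∀ i, (I i).Boundaryless]
    {M : ι → Type*} [∀ i, TopologicalSpace (M i)] [∀ i, ChartedSpace (H i) (M i)]
    (N : ℕ∞ω) [∀ i, IsManifold (I i) N (M i)] :
    IsManifold (ModelWithCorners.pi I) N (∀ i, M i) := by
  apply isManifold_of_contDiffOn
  rintro _ _ ⟨e, he, rfl⟩ ⟨e', he', rfl⟩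
  rw [contDiffOn_pi]
  intro i
  have h : ContDiffOn ℝ N (I i ∘ ((e i).symm ≫ₕ e' i) ∘ (I i).symm)
      ((I i).symm ⁻¹' ((e i).symm ≫ₕ e' i).source ∩ Set.range (I i)) :=
    (contDiffGroupoid N (I i)).compatible (he i (Set.mem_univ i)) (he' i (Set.mem_univ i)) |>.1
  have hp : ContDiffOn ℝ N (fun x : (∀ j, E j) => x i)
      ((ModelWithCorners.pi I).symm ⁻¹'
        ((OpenPartialHomeomorph.pi e).symm ≫ₕ OpenPartialHomeomorph.pi e').source ∩
          Set.range (ModelWithCorners.pi I)) := (ContinuousLinearMap.proj (R := ℝ) (φ := E) i).contDiff.contDiffOn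
  refine h.comp hp ?_
  rintro x ⟨hx, -⟩
  refine ⟨⟨hx.1 i (Set.mem_univ i), hx.2 i (Set.mem_univ i)⟩, ?_⟩
  rw [ModelWithCorners.Boundaryless.range_eq_univ]
  trivial

end PiManifold

/-! ### Riemannian metrics: completeness and curvature -/

section Riemannian

variable {E : Type*} [NormedAddCommGroup E] [NormedSpace ℝ E]
  {H : Type*} [TopologicalSpace H] {I : ModelWithCorners ℝ E H}
  {M : Type*} [TopologicalSpace M] [ChartedSpace H M] [IsManifold I ∞ M]

/-- Smooth Riemannian metrics on the manifold `M`. -/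
abbrev SmoothMetric (I : ModelWithCorners ℝ E H) (M : Type*) [TopologicalSpace M]
    [ChartedSpace H M] [IsManifold I ∞ M] : Type _ :=
  Bundle.ContMDiffRiemannianMetric I ∞ E (fun x : M => TangentSpace I x)

namespace SmoothMetric

open scoped Bundle in
/-- The metric `g` is complete: `M` is a complete metric space for the Riemannian distance of `g`
(the infimum of the `g`-lengths of `C^1` paths). -/
def IsComplete [T3Space M] (g : SmoothMetric I M) : Prop :=
  letI : Bundle.RiemannianBundle (fun x : M => TangentSpace I x) := ⟨g.toRiemannianMetric⟩
  letI : IsContinuousRiemannianBundle E (fun x : M => TangentSpace I x) :=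
    ⟨g.inner, g.contMDiff.continuous, fun _ _ _ => rfl⟩
  letI : EMetricSpace M := EMetricSpace.ofRiemannianMetric I M
  CompleteSpace M

variable [FiniteDimensional ℝ E] [I.Boundaryless]

/-- The metric `g` read in the chart centred at `p`: the bilinear form
`(v, w) ↦ g (dψ v, dψ w)` at the point `y`, with `ψ` the inverse of the chart. -/
def inChart (g : SmoothMetric I M) (p : M) (y : E) : E →L[ℝ] E →L[ℝ] ℝ :=
  let A : E →L[ℝ] TangentSpace I ((extChartAt I p).symm y) :=
    mfderiv 𝓘(ℝ, E) I (extChartAt I p).symm y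
  (ContinuousLinearMap.precomp ℝ A).comp ((g.inner ((extChartAt I p).symm y)).comp A)

/-- Christoffel symbols of the first kind in the chart centred at `p`, as the linear form
`w ↦ g (∇_u v, w) = (∂_u g(v, w) + ∂_v g(u, w) - ∂_w g(u, v)) / 2`
(`u`, `v`, `w` being constant vector fields in the chart). -/
def christoffelLower (g : SmoothMetric I M) (p : M) (y u v : E) : E →L[ℝ] ℝ :=
  let D : E →L[ℝ] E →L[ℝ] E →L[ℝ] ℝ := fderiv ℝ (g.inChart p) y
  (1 / 2 : ℝ) • (D u v + D v u - (D.flip u).flip v)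

/-- Christoffel symbols `Γ(u, v) = ∇_u v` of the Levi-Civita connection in the chart centred
at `p`, obtained by raising the index with the inverse of the metric. -/
def christoffel (g : SmoothMetric I M) (p : M) (y u v : E) : E :=
  (g.inChart p y).inverse (g.christoffelLower p y u v)

/-- The curvature `R(u, v) w = ∇_u ∇_v w - ∇_v ∇_u w` in the chart centred at `p`
(`u`, `v`, `w` being constant vector fields in the chart). -/
def curvatureInChart (g : SmoothMetric I M) (p : M) (y u v w : E) : E :=
  fderiv ℝ (fun z => g.christoffel p z v w) y u - fderiv ℝ (fun z => g.christoffel p z u w) y v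
    + g.christoffel p y u (g.christoffel p y v w) - g.christoffel p y v (g.christoffel p y u w)

/-- `Rm(v, w, v, w) = g (R(v, w) w, v)` for `v`, `w` tangent at `p`; this is the sectional
curvature of the plane they span when `v`, `w` are orthonormal. -/
def Rm (g : SmoothMetric I M) (p : M) (v w : TangentSpace I p) : ℝ :=
  let y : E := extChartAt I p p
  let d : TangentSpace I p →L[ℝ] E := mfderiv I 𝓘(ℝ, E) (extChartAt I p) p
  g.inChart p y (g.curvatureInChart p y (d v) (d w) (d w)) (d v)

/-- Orthonormal bases of the tangent space at `p`. -/
def IsOrthonormalFrame (g : SmoothMetric I M) (p : M)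
    (e : Fin (Module.finrank ℝ E) → TangentSpace I p) : Prop :=
  ∀ i j, g.inner p (e i) (e j) = if i = j then 1 else 0

/-- `C_m(e_1, …, e_m) = ∑_{a=1}^{m} ∑_{b=a+1}^{N} Rm(e_a, e_b, e_a, e_b)`, computed with an
orthonormal basis `e_1, …, e_N` of the tangent space at `p` which extends `e_1, …, e_m`
(`N = dim M`; the indices start from `0` in the code). -/
def frameIntermediateCurvature (g : SmoothMetric I M) (m : ℕ) (p : M)
    (e : Fin (Module.finrank ℝ E) → TangentSpace I p) : ℝ :=
  ∑ a : Fin (Module.finrank ℝ E), ∑ b : Fin (Module.finrank ℝ E),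
    if (a : ℕ) < m ∧ a < b then g.Rm p (e a) (e b) else 0

/-- `C_m(p)`, the minimum (as orthonormal frames form a compact set) of `C_m(e_1, …, e_m)` over
all orthonormal `e_1, …, e_m` tangent at `p`. -/
def intermediateCurvature (g : SmoothMetric I M) (m : ℕ) (p : M) : ℝ :=
  sInf {c | ∃ e, g.IsOrthonormalFrame p e ∧ c = g.frameIntermediateCurvature m p e}

end SmoothMetric

/-- The pullback at `p` of the inner product of `V` by a map `F : M → V`. -/
def pullbackForm {V : Type*} [NormedAddCommGroup V] [InnerProductSpace ℝ V]
    (I : ModelWithCorners ℝ E H) (F : M → V) (p : M) (v w : TangentSpace I p) : ℝ :=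
  let d : TangentSpace I p →L[ℝ] V := mfderiv I 𝓘(ℝ, V) F p
  inner ℝ (d v) (d w)

end Riemannian

/-! ### The manifold `S^k × T^l × ℝ` and the multiply warped metrics on it -/

/-- The unit sphere `S^k` in `ℝ^(k+1)`. -/
abbrev UnitSphere (k : ℕ) : Type := Metric.sphere (0 : EuclideanSpace ℝ (Fin (k + 1))) 1

/-- The torus `T^l`, a product of `l` unit circles. -/
abbrev Torus (l : ℕ) : Type := Fin l → Circle

/-- The manifold `S^k × T^l × ℝ`. -/
abbrev SphereTorusLine (k l : ℕ) : Type := UnitSphere k × Torus l × ℝ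

/-- The model with corners of the manifold `S^k × T^l × ℝ`. -/
abbrev modelSTL (k l : ℕ) :=
  (𝓡 k).prod ((ModelWithCorners.pi fun _ : Fin l => 𝓡 1).prod 𝓘(ℝ, ℝ))

/-- The symmetric bilinear form
`dr² + ε² f(r)² g_S + u(r)^(4/m) (dx_1² + ⋯ + dx_l²)` on `S^k × T^l × ℝ`, where `g_S` is the
round metric of the unit sphere and `dx_i²` is the metric of the `i`-th unit circle. -/
def warpedForm (k l m : ℕ) (ε : ℝ) (f u : ℝ → ℝ) (p : SphereTorusLine k l)
    (v w : TangentSpace (modelSTL k l) p) : ℝ :=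
  pullbackForm (modelSTL k l) (fun q : SphereTorusLine k l => q.2.2) p v w
    + ε ^ 2 * f p.2.2 ^ 2 * pullbackForm (modelSTL k l)
        (fun q : SphereTorusLine k l => (q.1 : EuclideanSpace ℝ (Fin (k + 1)))) p v w
    + u p.2.2 ^ (4 / (m : ℝ)) * ∑ i : Fin l, pullbackForm (modelSTL k l)
        (fun q : SphereTorusLine k l => (q.2.1 i : ℂ)) p v w

/-- `C₃ = -2 / (n - m - 2)`. -/
def constC₃ (n m : ℝ) : ℝ := -2 / (n - m - 2)

/-- `C₄ = ((n - m) - 2 m / (m - 1)) / (n - m - 2)²`. -/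
def constC₄ (n m : ℝ) : ℝ := ((n - m) - 2 * m / (m - 1)) / (n - m - 2) ^ 2

/-- The warping function `f`: Gaussian if `4 / (n - m) = (2 m - 2) / m`, and a power of `cosh`
otherwise. -/
def warpF (n m lam r : ℝ) : ℝ :=
  if 4 / (n - m) = (2 * m - 2) / m then
    Real.exp (-(lam * r ^ 2 / (2 * (n - m - 2))))
  else
    Real.cosh (√(constC₄ n m * lam) * r) ^ ((constC₃ n m - 1) / ((n - m) * constC₄ n m))

/-- The warping function `u`: Gaussian if `4 / (n - m) = (2 m - 2) / m`, and a power of `cosh`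
otherwise. -/
def warpU (n m lam r : ℝ) : ℝ :=
  if 4 / (n - m) = (2 * m - 2) / m then
    Real.exp (m * lam * r ^ 2 / ((2 * m - 2) * (n - m - 2)))
  else
    Real.cosh (√(constC₄ n m * lam) * r) ^ (-(m * constC₃ n m / ((2 * m - 2) * constC₄ n m)))

end

/-! Put k = n - m and l = m - 1, and write f = exp(-S), u^(4/m) = exp(4S/l), s = S'. In coordinates
orthonormal at a point, the curvature operator of the warped metric is diagonal on the coordinate
planes. Its eigenvalue on planes inside the sphere is κ = exp(2S)/ε² - s²; the other eigenvalues do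
not involve ε. The m-frame tangent to the torus and the line meets each of those other planes once,
and its curvature sum is (k - 2) s' + (k - 2m/(m - 1)) s². The warping functions are those for which
this equals λ identically. Since (m - 1)(k - 2m/(m - 1)) = -(m² - mn + m + n), the coefficient of s²
is nonnegative exactly when the inequality fails. If it vanishes, S is quadratic; if it is positive,
the equation is of Riccati type and is solved by the logarithm of a cosh
(`exists_isWarpingExponent`).

For another m-frame, let δ be the part of the trace of the orthogonal projection to its span that
falls on the sphere directions. If L bounds the eigenvalues other than κ, passing from the
torus-line frame to this one costs at most L δ on each pair of indices, while the sphere planes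
contribute at least a multiple of κ δ. So κ ≥ n² L makes the torus-line frame minimal
(`le_sum_frame_of_diagonal`). As L and s² are bounded by constants times exp(2S), one small ε serves
for all r (`IsWarpingExponent.le_intermediateCurvature`).

The curvature is computed in the chart centred at the point, a product of stereographic projections,
where the conformal factors are 1 to first order (`stereoMetric_curvatureInChart`). Completeness
holds because r is proper with gradient of norm at most 1. -/

noncomputable section

set_option maxSynthPendingDepth 3

/-! ### Pullback forms, smoothness and completeness of metrics on a general manifold -/

section GenericMetric

variable {E : Type*} [NormedAddCommGroup E] [NormedSpace ℝ E]
  {H : Type*} [TopologicalSpace H] {I : ModelWithCorners ℝ E H}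
  {M : Type*} [TopologicalSpace M] [ChartedSpace H M] [IsManifold I ∞ M] [I.Boundaryless]

theorem mdifferentiableAt_extChartAt_symm {p : M} {y : E} (hy : y ∈ (extChartAt I p).target) :
    MDifferentiableAt 𝓘(ℝ, E) I (extChartAt I p).symm y := by
  have : IsManifold I 1 M := IsManifold.of_le (n := ∞) (by norm_cast)
  have h := mdifferentiableWithinAt_extChartAt_symm hy
  rwa [I.range_eq_univ, mdifferentiableWithinAt_univ] at h

/-- The pullback form of `F`, read in a chart, is the pullback of the inner product by the
derivative of `F` read in the chart. -/
theorem pullbackForm_mfderiv_extChartAt_symm {V : Type*} [NormedAddCommGroup V]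
    [InnerProductSpace ℝ V] {F : M → V} (hF : MDifferentiable I 𝓘(ℝ, V) F) {p : M} {y : E}
    (hy : y ∈ (extChartAt I p).target) (v w : E) :
    pullbackForm I F ((extChartAt I p).symm y)
        (mfderiv 𝓘(ℝ, E) I (extChartAt I p).symm y v)
        (mfderiv 𝓘(ℝ, E) I (extChartAt I p).symm y w) =
      inner ℝ (fderiv ℝ (F ∘ (extChartAt I p).symm) y v)
        (fderiv ℝ (F ∘ (extChartAt I p).symm) y w) := by
  have h := mfderiv_comp y (hF ((extChartAt I p).symm y)) (mdifferentiableAt_extChartAt_symm hy)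
  rw [mfderiv_eq_fderiv] at h
  rw [h]
  rfl

theorem pullbackForm_eq_inner_fderiv {V : Type*} [NormedAddCommGroup V]
    [InnerProductSpace ℝ V] {F : M → V} (hF : MDifferentiable I 𝓘(ℝ, V) F) {p : M}
    (v w : E) :
    pullbackForm I F p v w =
      inner ℝ (fderiv ℝ (F ∘ (extChartAt I p).symm) (extChartAt I p p) v)
        (fderiv ℝ (F ∘ (extChartAt I p).symm) (extChartAt I p p) w) := by
  have h := (hF p).mfderiv
  rw [I.range_eq_univ, fderivWithin_univ] at h
  change @inner ℝ V _ (mfderiv I 𝓘(ℝ, V) F p v) (mfderiv I 𝓘(ℝ, V) F p w) = _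
  rw [h]
  rfl

/-- The tangent bundle trivialization at `p` is inverted by the derivative of the inverse chart, so
the coordinate expression of `g` near `p` is `G p` composed with the chart. -/
theorem contMDiff_of_inChart_contDiff
    (g : ∀ p : M, TangentSpace I p →L[ℝ] TangentSpace I p →L[ℝ] ℝ)
    (G : M → E → E →L[ℝ] E →L[ℝ] ℝ) (hG : ∀ p, ContDiff ℝ ∞ (G p))
    (h : ∀ p, ∀ y ∈ (extChartAt I p).target, ∀ v w : E,
      g ((extChartAt I p).symm y) (mfderiv 𝓘(ℝ, E) I (extChartAt I p).symm y v)
        (mfderiv 𝓘(ℝ, E) I (extChartAt I p).symm y w) = G p y v w) :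
    ContMDiff I (I.prod 𝓘(ℝ, E →L[ℝ] E →L[ℝ] ℝ)) ∞
      (fun b ↦ Bundle.TotalSpace.mk' (E →L[ℝ] E →L[ℝ] ℝ)
        (E := fun b ↦ TangentSpace I b →L[ℝ] TangentSpace I b →L[ℝ] ℝ) b (g b)) := by
  have : IsManifold I 1 M := IsManifold.of_le (n := ∞) (by norm_cast)
  intro p
  rw [Bundle.contMDiffAt_section]
  have h1 : ContMDiffAt I 𝓘(ℝ, E →L[ℝ] E →L[ℝ] ℝ) ∞ (fun x => G p (extChartAt I p x)) p :=
    (hG p).contMDiff.contMDiffAt.comp p contMDiffAt_extChartAt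
  refine h1.congr_of_eventuallyEq ?_
  filter_upwards [(chartAt H p).open_source.mem_nhds (mem_chart_source H p)] with x hx
  have hx' : x ∈ (extChartAt I p).source := by rwa [extChartAt_source]
  ext v w
  rw [hom_trivializationAt_apply]
  dsimp only
  rw [inCoordinates_apply_eq₂ (by simpa using hx) (by simpa using hx) (by simp)]
  have hs : ∀ v : E, (trivializationAt E (TangentSpace I) p).symm x v =
      mfderiv 𝓘(ℝ, E) I (extChartAt I p).symm (extChartAt I p x) v := by
    intro v
    have := congrArg (fun A => A v) (TangentBundle.symmL_trivializationAt (I := I) (𝕜 := ℝ) hx)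
    rw [I.range_eq_univ, mfderivWithin_univ] at this
    exact (Bundle.Trivialization.symmL_apply (R := ℝ) _ (by simpa using hx) v).symm.trans this
  have ht : ∀ c : ℝ, (trivializationAt ℝ (Bundle.Trivial M ℝ) p).linearMapAt ℝ x c = c := by
    simp
  rw [hs, hs]
  refine (ht _).trans ?_
  rw [← h p _ ((extChartAt I p).map_source hx')]
  -- The inverse chart returns to `x` only up to a propositional equality, so `g` has to be
  -- transported along it.
  have hb : ∀ x', x' = x → ∀ a b : E,
      g x' (show TangentSpace I x' from a) (show TangentSpace I x' from b) =
        g x (show TangentSpace I x from a) (show TangentSpace I x from b) := by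
    rintro _ rfl a b
    rfl
  exact (hb _ ((extChartAt I p).left_inv hx') _ _).symm

open MeasureTheory Manifold Bundle in
open scoped Bundle in
-- A map with gradient of norm at most 1 does not lengthen paths, and the distance of ℝ is its own
-- Riemannian distance.
theorem edist_le_riemannianEDist [IsManifold I 1 M]
    [Bundle.RiemannianBundle (fun x : M => TangentSpace I x)]
    {ρ : M → ℝ} (hρ : ContMDiff I 𝓘(ℝ, ℝ) 1 ρ)
    (hle : ∀ p (v : TangentSpace I p), pullbackForm I ρ p v v ≤ ‖v‖ ^ 2) (x y : M) :
    edist (ρ x) (ρ y) ≤ riemannianEDist I x y := by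
  refine le_of_forall_gt fun r hr => ?_
  obtain ⟨γ, h0, h1, hγ, hlt⟩ := exists_lt_of_riemannianEDist_lt hr
  refine lt_of_le_of_lt ?_ hlt
  rw [IsRiemannianManifold.out (I := 𝓘(ℝ, ℝ)) (ρ x) (ρ y)]
  refine (riemannianEDist_le_pathELength (γ := ρ ∘ γ) (a := 0) (b := 1)
    (hρ.comp_contMDiffOn hγ) (by simp [h0]) (by simp [h1]) zero_le_one).trans ?_
  rw [pathELength_eq_lintegral_mfderivWithin_Icc, pathELength_eq_lintegral_mfderivWithin_Icc]
  refine setLIntegral_mono' measurableSet_Icc fun t ht => ?_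
  have hu : UniqueMDiffWithinAt 𝓘(ℝ, ℝ) (Set.Icc (0:ℝ) 1) t :=
    (uniqueDiffOn_Icc zero_lt_one).uniqueMDiffOn t ht
  rw [mfderiv_comp_mfderivWithin t (hρ.mdifferentiableAt one_ne_zero)
    (hγ.mdifferentiableOn one_ne_zero t ht) hu, enorm_tangentSpace_vectorSpace]
  have := hle (γ t) (mfderivWithin 𝓘(ℝ, ℝ) I γ (Set.Icc 0 1) t 1)
  rw [pullbackForm, real_inner_self_eq_norm_sq] at this
  replace this := (sq_le_sq₀ (norm_nonneg _) (norm_nonneg _)).1 this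
  replace this := ENNReal.ofReal_le_ofReal this
  rw [ofReal_norm, ofReal_norm] at this
  exact this

open scoped Bundle in
/-- A metric for which a proper function has gradient of norm at most `1` is complete. -/
theorem SmoothMetric.isComplete_of_proper [T3Space M] (g : SmoothMetric I M) {ρ : M → ℝ}
    (hρ : ContMDiff I 𝓘(ℝ, ℝ) 1 ρ)
    (hle : ∀ p (v : TangentSpace I p), pullbackForm I ρ p v v ≤ g.inner p v v)
    (hK : ∀ a b : ℝ, IsCompact (ρ ⁻¹' Set.Icc a b)) : g.IsComplete := by
  have : IsManifold I 1 M := IsManifold.of_le (n := ∞) (by norm_cast)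
  unfold SmoothMetric.IsComplete
  let : Bundle.RiemannianBundle (fun x : M => TangentSpace I x) := ⟨g.toRiemannianMetric⟩
  let : IsContinuousRiemannianBundle E (fun x : M => TangentSpace I x) :=
    ⟨g.inner, g.contMDiff.continuous, fun _ _ _ => rfl⟩
  let : EMetricSpace M := EMetricSpace.ofRiemannianMetric I M
  change CompleteSpace M
  have hle' : ∀ p (v : TangentSpace I p), pullbackForm I ρ p v v ≤ ‖v‖ ^ 2 := fun p v =>
    (hle p v).trans (real_inner_self_eq_norm_sq v).le
  have hed : ∀ x y : M, edist (ρ x) (ρ y) ≤ edist x y := fun x y =>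
    edist_le_riemannianEDist hρ hle' x y
  have hlip : LipschitzWith 1 ρ := fun x y => by simpa using hed x y
  -- Along a Cauchy sequence `ρ` stays bounded, so the sequence lies in a compact set and has a
  -- convergent subsequence.
  refine EMetric.complete_of_cauchySeq_tendsto fun u hu => ?_
  have hc : CauchySeq (ρ ∘ u) := hlip.uniformContinuous.comp_cauchySeq hu
  obtain ⟨R, hR⟩ := hc.isBounded_range.subset_closedBall 0
  have hmem : ∀ n, u n ∈ ρ ⁻¹' Set.Icc (0 - R) (0 + R) := fun n => by
    rw [Set.mem_preimage, ← Real.closedBall_eq_Icc]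
    exact hR ⟨n, rfl⟩
  obtain ⟨a, -, φ, hφ, ha⟩ := (hK (0 - R) (0 + R)).tendsto_subseq hmem
  exact ⟨a, tendsto_nhds_of_cauchySeq_of_subseq hu hφ.tendsto_atTop ha⟩

end GenericMetric

/-! ### Inverse stereographic projection is conformal -/

section Stereographic

open Module

variable {V : Type*} [NormedAddCommGroup V] [InnerProductSpace ℝ V]

/-- The conformal factor of the inverse stereographic projection. -/
def stereoFactor (x : V) : ℝ := 16 / (‖x‖ ^ 2 + 4) ^ 2

theorem stereoFactor_pos (x : V) : 0 < stereoFactor x := by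
  unfold stereoFactor; positivity

theorem contDiff_stereoFactor {N : ℕ∞ω} : ContDiff ℝ N (stereoFactor : V → ℝ) :=
  contDiff_const.div (((contDiff_norm_sq ℝ).add contDiff_const).pow 2) fun x => by positivity

theorem hasFDerivAt_stereoFactor (x : V) :
    HasFDerivAt (stereoFactor : V → ℝ)
      ((-(4 / (‖x‖ ^ 2 + 4)) * stereoFactor x) • innerSL ℝ x) x := by
  have hq : HasFDerivAt (fun x : V => ‖x‖ ^ 2 + 4) (2 • innerSL ℝ x) x :=
    (hasStrictFDerivAt_norm_sq x).hasFDerivAt.add_const 4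
  have hne : (‖x‖ ^ 2 + 4) ^ 2 ≠ 0 := by positivity
  have h := ((hasDerivAt_inv hne).comp_hasFDerivAt x (hq.pow 2)).const_mul 16
  refine (h.congr_fderiv ?_).congr_of_eventuallyEq (Filter.Eventually.of_forall fun y => ?_)
  · ext w
    simp [stereoFactor]
    field_simp
    ring
  · simp [stereoFactor, div_eq_mul_inv]

variable {W : Type*} [NormedAddCommGroup W] [InnerProductSpace ℝ W]

theorem hasFDerivAt_stereo (ι : W →L[ℝ] V)
    (e : V) (x : W) :
    HasFDerivAt (fun x : W => (‖x‖ ^ 2 + 4)⁻¹ • (4 : ℝ) • ι x +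
        (‖x‖ ^ 2 + 4)⁻¹ • (‖x‖ ^ 2 - 4) • e)
      ((4 / (‖x‖ ^ 2 + 4)) • ι + (innerSL ℝ x).smulRight
        ((-8 / (‖x‖ ^ 2 + 4) ^ 2) • ι x + (16 / (‖x‖ ^ 2 + 4) ^ 2) • e)) x := by
  have hn : HasFDerivAt (fun x : W => ‖x‖ ^ 2) (2 • innerSL ℝ x) x :=
    (hasStrictFDerivAt_norm_sq x).hasFDerivAt
  have hne : ‖x‖ ^ 2 + 4 ≠ 0 := by positivity
  have hi := (hasDerivAt_inv hne).comp_hasFDerivAt x (hn.add_const 4)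
  have h := (hi.smul (ι.hasFDerivAt.const_smul (4 : ℝ))).add
    (hi.smul ((hn.sub_const 4).smul_const e))
  refine h.congr_fderiv ?_
  ext w
  simp
  match_scalars <;> field_simp <;> ring

/-- With q = ‖x‖² + 4, the terms in ⟨x, v⟩⟨x, w⟩ add up to 64 (-q + ‖x‖² + 4) / q⁴ = 0, which leaves
only the conformal part. -/
theorem inner_fderiv_stereo (ι : W →L[ℝ] V) (hι : ∀ x y, inner ℝ (ι x) (ι y) = inner ℝ x y)
    {e : V} (he : ‖e‖ = 1) (hιe : ∀ x, inner ℝ (ι x) e = 0) (x v w : W) :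
    inner ℝ
      (((4 / (‖x‖ ^ 2 + 4)) • ι + (innerSL ℝ x).smulRight
        ((-8 / (‖x‖ ^ 2 + 4) ^ 2) • ι x + (16 / (‖x‖ ^ 2 + 4) ^ 2) • e)) v)
      (((4 / (‖x‖ ^ 2 + 4)) • ι + (innerSL ℝ x).smulRight
        ((-8 / (‖x‖ ^ 2 + 4) ^ 2) • ι x + (16 / (‖x‖ ^ 2 + 4) ^ 2) • e)) w) =
      stereoFactor x * inner ℝ v w := by
  have hee : inner ℝ e e = (1 : ℝ) := by rw [real_inner_self_eq_norm_sq, he]; norm_num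
  have hie : ∀ x, inner ℝ e (ι x) = (0 : ℝ) := fun x => by rw [real_inner_comm]; exact hιe x
  have hne : ‖x‖ ^ 2 + 4 ≠ 0 := by positivity
  simp only [add_apply, smul_apply,
    ContinuousLinearMap.smulRight_apply, innerSL_apply_apply, inner_add_left, inner_add_right,
    real_inner_smul_left, real_inner_smul_right, hι, hιe, hie, hee, real_inner_self_eq_norm_sq,
    stereoFactor, real_inner_comm x v]
  field_simp
  ring

variable {n : ℕ} [Fact (finrank ℝ V = n + 1)]

theorem stereographic'_symm_contDiff (v : Metric.sphere (0 : V) 1) {N : ℕ∞ω} :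
    ContDiff ℝ N (fun x => ((stereographic' n v).symm x : V)) := by
  have := ((contDiff_stereoInvFunAux (v := (v : V)) (m := N)).comp
    (Submodule.subtypeL (ℝ ∙ (v : V))ᗮ).contDiff).comp
    (OrthonormalBasis.fromOrthogonalSpanSingleton n
      (ne_zero_of_mem_unit_sphere v)).repr.symm.contDiff
  exact this

theorem inner_fderiv_stereographic'_symm (v : Metric.sphere (0 : V) 1)
    (x a b : EuclideanSpace ℝ (Fin n)) :
    inner ℝ (fderiv ℝ (fun x => ((stereographic' n v).symm x : V)) x a)
      (fderiv ℝ (fun x => ((stereographic' n v).symm x : V)) x b) =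
      stereoFactor x * inner ℝ a b := by
  let U := (OrthonormalBasis.fromOrthogonalSpanSingleton (𝕜 := ℝ) n
    (ne_zero_of_mem_unit_sphere v)).repr
  let ι : EuclideanSpace ℝ (Fin n) →L[ℝ] V :=
    (Submodule.subtypeL (ℝ ∙ (v : V))ᗮ).comp (U.symm : _ →L[ℝ] _)
  have hι : ∀ x y, inner ℝ (ι x) (ι y) = inner ℝ x y := fun x y => by
    exact U.symm.inner_map_map x y
  have hn : ∀ x, ‖(U.symm x : V)‖ = ‖x‖ := fun x => U.symm.norm_map x
  have hf : (fun x => ((stereographic' n v).symm x : V)) = fun x : EuclideanSpace ℝ (Fin n) =>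
      (‖x‖ ^ 2 + 4)⁻¹ • (4 : ℝ) • ι x + (‖x‖ ^ 2 + 4)⁻¹ • (‖x‖ ^ 2 - 4) • (v : V) := by
    funext x
    rw [stereographic'_symm_apply]
    dsimp only
    rw [show ‖(((OrthonormalBasis.fromOrthogonalSpanSingleton (𝕜 := ℝ) n
      (ne_zero_of_mem_unit_sphere v)).repr.symm x : (ℝ ∙ (v : V))ᗮ) : V)‖ = ‖x‖ from hn x]
    rfl
  rw [hf, (hasFDerivAt_stereo ι v x).fderiv]
  refine inner_fderiv_stereo ι hι (norm_eq_of_mem_sphere v) (fun x => ?_) x a b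
  exact Submodule.mem_orthogonal_singleton_iff_inner_left.1 (U.symm x).2

end Stereographic

/-! ### The warped metric in the product of stereographic charts -/

section ProductChart

variable {k l : ℕ}

/-- The model vector space of the manifold `S^k × T^l × ℝ`. -/
abbrev ModelSpaceSTL (k l : ℕ) : Type :=
  EuclideanSpace ℝ (Fin k) × ((Fin l → EuclideanSpace ℝ (Fin 1)) × ℝ)

namespace ModelSpaceSTL

/-- The projection to the sphere coordinates. -/
def sphereProj (k l : ℕ) : ModelSpaceSTL k l →L[ℝ] EuclideanSpace ℝ (Fin k) :=
  ContinuousLinearMap.fst ℝ _ _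

/-- The projection to the coordinate of the `i`-th circle. -/
def circleProj (k l : ℕ) (i : Fin l) : ModelSpaceSTL k l →L[ℝ] EuclideanSpace ℝ (Fin 1) :=
  ((ContinuousLinearMap.proj i).comp (ContinuousLinearMap.fst ℝ _ _)).comp
    (ContinuousLinearMap.snd ℝ _ _)

/-- The projection to the coordinate of the line. -/
def lineProj (k l : ℕ) : ModelSpaceSTL k l →L[ℝ] ℝ :=
  (ContinuousLinearMap.snd ℝ _ _).comp (ContinuousLinearMap.snd ℝ _ _)

@[simp] theorem sphereProj_apply (x : ModelSpaceSTL k l) : sphereProj k l x = x.1 := rfl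

@[simp] theorem circleProj_apply (i : Fin l) (x : ModelSpaceSTL k l) :
    circleProj k l i x = x.2.1 i := rfl

@[simp] theorem lineProj_apply (x : ModelSpaceSTL k l) : lineProj k l x = x.2.2 := rfl

end ModelSpaceSTL

open ModelSpaceSTL

/-- The pullback of the inner product by a linear map. -/
def pullbackInner {E V : Type*} [NormedAddCommGroup E] [NormedSpace ℝ E] [NormedAddCommGroup V]
    [InnerProductSpace ℝ V] (A : E →L[ℝ] V) : E →L[ℝ] E →L[ℝ] ℝ :=
  (innerSL ℝ).bilinearComp A A

@[simp] theorem pullbackInner_apply {E V : Type*} [NormedAddCommGroup E] [NormedSpace ℝ E]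
    [NormedAddCommGroup V] [InnerProductSpace ℝ V] (A : E →L[ℝ] V) (v w : E) :
    pullbackInner A v w = inner ℝ (A v) (A w) := rfl

/-- The metric `dr² + P(r) g_S + Q(r) (dx_1² + ⋯ + dx_l²)` in stereographic coordinates. -/
def stereoMetric (k l : ℕ) (P Q : ℝ → ℝ) (y : ModelSpaceSTL k l) :
    ModelSpaceSTL k l →L[ℝ] ModelSpaceSTL k l →L[ℝ] ℝ :=
  pullbackInner (lineProj k l) + (P y.2.2 * stereoFactor y.1) • pullbackInner (sphereProj k l)
    + ∑ i, (Q y.2.2 * stereoFactor (y.2.1 i)) • pullbackInner (circleProj k l i)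

theorem stereoMetric_apply (P Q : ℝ → ℝ) (y v w : ModelSpaceSTL k l) :
    stereoMetric k l P Q y v w = v.2.2 * w.2.2 + P y.2.2 * stereoFactor y.1 * inner ℝ v.1 w.1
      + ∑ i, Q y.2.2 * stereoFactor (y.2.1 i) * inner ℝ (v.2.1 i) (w.2.1 i) := by
  simp [stereoMetric, mul_comm w.2.2]

theorem contDiff_stereoMetric {P Q : ℝ → ℝ} (hP : ContDiff ℝ ∞ P) (hQ : ContDiff ℝ ∞ Q) :
    ContDiff ℝ ∞ (stereoMetric k l P Q) := by
  have hr : ContDiff ℝ ∞ (fun y : ModelSpaceSTL k l => y.2.2) := (lineProj k l).contDiff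
  have hS : ContDiff ℝ ∞ (fun y : ModelSpaceSTL k l => stereoFactor y.1) :=
    contDiff_stereoFactor.comp (sphereProj k l).contDiff
  have hT : ∀ i, ContDiff ℝ ∞ (fun y : ModelSpaceSTL k l => stereoFactor (y.2.1 i)) := fun i =>
    contDiff_stereoFactor.comp (circleProj k l i).contDiff
  exact (contDiff_const.add (((hP.comp hr).mul hS).smul contDiff_const)).add
    (ContDiff.sum fun i _ => ((hQ.comp hr).mul (hT i)).smul contDiff_const)

theorem stereoMetric_pos {P Q : ℝ → ℝ} (hP : ∀ r, 0 < P r) (hQ : ∀ r, 0 < Q r)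
    (y v : ModelSpaceSTL k l) (hv : v ≠ 0) : 0 < stereoMetric k l P Q y v v := by
  rw [stereoMetric_apply]
  simp only [real_inner_self_eq_norm_sq]
  have hc : ∀ i, 0 ≤ Q y.2.2 * stereoFactor (y.2.1 i) * ‖v.2.1 i‖ ^ 2 := fun i =>
    mul_nonneg (mul_pos (hQ _) (stereoFactor_pos _)).le (sq_nonneg _)
  have hs : 0 ≤ P y.2.2 * stereoFactor y.1 * ‖v.1‖ ^ 2 :=
    mul_nonneg (mul_pos (hP _) (stereoFactor_pos _)).le (sq_nonneg _)
  have hsum := Finset.sum_nonneg (s := Finset.univ) fun i _ => hc i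
  by_contra hcon
  have hr := mul_self_nonneg v.2.2
  apply hv
  have h1 : v.2.2 = 0 := mul_self_eq_zero.1 (by linarith)
  have h2 : v.1 = 0 := by
    have : P y.2.2 * stereoFactor y.1 * ‖v.1‖ ^ 2 = 0 := by linarith
    simpa [(hP _).ne', (stereoFactor_pos _).ne'] using this
  have h3 : v.2.1 = 0 := by
    have : ∑ i, Q y.2.2 * stereoFactor (y.2.1 i) * ‖v.2.1 i‖ ^ 2 = 0 := by linarith
    rw [Finset.sum_eq_zero_iff_of_nonneg fun i _ => hc i] at this
    funext i
    simpa [(hQ _).ne', (stereoFactor_pos _).ne'] using this i (Finset.mem_univ i)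
  exact Prod.ext h2 (Prod.ext h3 h1)

instance fact_finrank_complex : Fact (Module.finrank ℝ ℂ = 1 + 1) := finrank_real_complex_fact'

instance fact_finrank_euclideanSpace (n : ℕ) :
    Fact (Module.finrank ℝ (EuclideanSpace ℝ (Fin (n + 1))) = n + 1) :=
  ⟨finrank_euclideanSpace_fin⟩

/-- Stereographic projection maps onto the whole Euclidean space, so the inverse charts are global
and no domain conditions arise later. -/
theorem extChartAt_modelSTL_target (p : SphereTorusLine k l) :
    (extChartAt (modelSTL k l) p).target = Set.univ := by
  have h : ∀ (n : ℕ) (V : Type) [NormedAddCommGroup V] [InnerProductSpace ℝ V]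
      [Fact (Module.finrank ℝ V = n + 1)] (v : Metric.sphere (0 : V) 1)
      (x : EuclideanSpace ℝ (Fin n)),
      x ∈ (stereographic' n v).target := by simp
  refine Set.eq_univ_of_forall fun y => ?_
  rw [extChartAt_target]
  refine ⟨⟨h _ _ _ _, fun i _ => ?_, trivial⟩, ?_⟩
  · exact h _ _ _ _
  · rw [(modelSTL k l).range_eq_univ]; trivial

theorem extChartAt_modelSTL_symm_line (p : SphereTorusLine k l) (y : ModelSpaceSTL k l) :
    ((extChartAt (modelSTL k l) p).symm y).2.2 = y.2.2 := rfl

theorem extChartAt_modelSTL_self_fst (p : SphereTorusLine k l) :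
    (extChartAt (modelSTL k l) p p).1 = stereographic' k (-p.1) p.1 := rfl

theorem extChartAt_modelSTL_self_circle (p : SphereTorusLine k l) (i : Fin l) :
    (extChartAt (modelSTL k l) p p).2.1 i =
      stereographic' (E := ℂ) 1 (-(show Metric.sphere (0 : ℂ) 1 from p.2.1 i))
        (show Metric.sphere (0 : ℂ) 1 from p.2.1 i) := rfl

theorem extChartAt_modelSTL_self_line (p : SphereTorusLine k l) :
    (extChartAt (modelSTL k l) p p).2.2 = p.2.2 := rfl

theorem finrank_modelSpaceSTL : Module.finrank ℝ (ModelSpaceSTL k l) = k + (l + 1) := by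
  simp [Module.finrank_pi_fintype]

/-- The chart centred at a point projects from its antipode. Hence every point sits at the origin of
its own sphere and circle coordinates, and the curvature is needed only there. -/
theorem stereographic'_neg_self {V : Type*} [NormedAddCommGroup V] [InnerProductSpace ℝ V] {n : ℕ}
    [Fact (Module.finrank ℝ V = n + 1)] (v : Metric.sphere (0 : V) 1) :
    stereographic' n (-v) v = 0 := by
  simp only [stereographic', OpenPartialHomeomorph.coe_trans, Function.comp_apply]
  rw [stereographic_neg_apply]
  exact map_zero (OrthonormalBasis.fromOrthogonalSpanSingleton (𝕜 := ℝ) n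
    (ne_zero_of_mem_unit_sphere (-v))).repr

theorem contMDiff_sphere_coe : ContMDiff (modelSTL k l) 𝓘(ℝ, EuclideanSpace ℝ (Fin (k + 1))) ∞
    (fun q : SphereTorusLine k l => (q.1 : EuclideanSpace ℝ (Fin (k + 1)))) :=
  (contMDiff_coe_sphere (E := EuclideanSpace ℝ (Fin (k + 1)))).comp contMDiff_fst

theorem contMDiff_line : ContMDiff (modelSTL k l) 𝓘(ℝ, ℝ) ∞
    (fun q : SphereTorusLine k l => q.2.2) :=
  contMDiff_snd.comp contMDiff_snd

theorem contMDiff_circle_coe (i : Fin l) : ContMDiff (modelSTL k l) 𝓘(ℝ, ℂ) ∞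
    (fun q : SphereTorusLine k l => (q.2.1 i : ℂ)) := by
  rw [contMDiff_iff]
  refine ⟨by fun_prop, fun p y => ?_⟩
  have : ContDiff ℝ ∞ (fun y : ModelSpaceSTL k l => ((stereographic' (E := ℂ) 1
      (-(show Metric.sphere (0 : ℂ) 1 from p.2.1 i))).symm (y.2.1 i) : ℂ)) :=
    (stereographic'_symm_contDiff _).comp (circleProj k l i).contDiff
  exact this.contDiffOn

theorem fderiv_line_comp_extChartAt_symm (p : SphereTorusLine k l) (y : ModelSpaceSTL k l) :
    fderiv ℝ ((fun q : SphereTorusLine k l => q.2.2) ∘ (extChartAt (modelSTL k l) p).symm) y =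
      lineProj k l :=
  (lineProj k l).fderiv

theorem fderiv_sphere_comp_extChartAt_symm (p : SphereTorusLine k l) (y : ModelSpaceSTL k l) :
    fderiv ℝ ((fun q : SphereTorusLine k l => (q.1 : EuclideanSpace ℝ (Fin (k + 1)))) ∘
        (extChartAt (modelSTL k l) p).symm) y =
      (fderiv ℝ (fun x => ((stereographic' k (-p.1)).symm x : EuclideanSpace ℝ (Fin (k + 1))))
        y.1).comp (sphereProj k l) :=
  fderiv_comp (x := y) (f := sphereProj k l)
    (g := fun x => ((stereographic' k (-p.1)).symm x : EuclideanSpace ℝ (Fin (k + 1))))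
    ((stereographic'_symm_contDiff (N := 1) _).differentiable one_ne_zero _)
    (sphereProj k l).differentiableAt |>.trans (by rw [ContinuousLinearMap.fderiv]; rfl)

theorem fderiv_circle_comp_extChartAt_symm (p : SphereTorusLine k l) (y : ModelSpaceSTL k l)
    (i : Fin l) : fderiv ℝ ((fun q : SphereTorusLine k l => (q.2.1 i : ℂ)) ∘
        (extChartAt (modelSTL k l) p).symm) y =
      (fderiv ℝ (fun x => ((stereographic' (E := ℂ) 1
        (-(show Metric.sphere (0 : ℂ) 1 from p.2.1 i))).symm x : ℂ))
        (y.2.1 i)).comp (circleProj k l i) :=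
  fderiv_comp (x := y) (f := circleProj k l i)
    (g := fun x => ((stereographic' (E := ℂ) 1
      (-(show Metric.sphere (0 : ℂ) 1 from p.2.1 i))).symm x : ℂ))
    ((stereographic'_symm_contDiff (N := 1) _).differentiable one_ne_zero _)
    (circleProj k l i).differentiableAt |>.trans (by rw [ContinuousLinearMap.fderiv]; rfl)

theorem warpedForm_mfderiv_extChartAt_symm (m : ℕ) (ε : ℝ) (f u : ℝ → ℝ)
    (p : SphereTorusLine k l) (y v w : ModelSpaceSTL k l) :
    warpedForm k l m ε f u ((extChartAt (modelSTL k l) p).symm y)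
        (mfderiv 𝓘(ℝ, ModelSpaceSTL k l) (modelSTL k l) (extChartAt (modelSTL k l) p).symm y v)
        (mfderiv 𝓘(ℝ, ModelSpaceSTL k l) (modelSTL k l) (extChartAt (modelSTL k l) p).symm y w) =
      stereoMetric k l (fun r => ε ^ 2 * f r ^ 2) (fun r => u r ^ (4 / (m : ℝ))) y v w := by
  have hy : y ∈ (extChartAt (modelSTL k l) p).target := by
    rw [extChartAt_modelSTL_target]; trivial
  rw [warpedForm, pullbackForm_mfderiv_extChartAt_symm
      (contMDiff_line.mdifferentiable (by simp)) hy,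
    pullbackForm_mfderiv_extChartAt_symm (contMDiff_sphere_coe.mdifferentiable (by simp)) hy,
    Finset.sum_congr rfl fun i _ => pullbackForm_mfderiv_extChartAt_symm
      ((contMDiff_circle_coe i).mdifferentiable (by simp)) hy v w]
  simp only [fderiv_line_comp_extChartAt_symm, fderiv_sphere_comp_extChartAt_symm,
    fderiv_circle_comp_extChartAt_symm, ContinuousLinearMap.comp_apply,
    inner_fderiv_stereographic'_symm, stereoMetric_apply, extChartAt_modelSTL_symm_line,
    Finset.mul_sum, lineProj_apply, sphereProj_apply, circleProj_apply]
  simp [mul_assoc, mul_comm]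

/-- The tangent space at `p` is the model space through the chart at `p`, so no derivative of the
chart appears. This gives the form as a continuous bilinear map. -/
theorem warpedForm_eq_stereoMetric (m : ℕ) (ε : ℝ) (f u : ℝ → ℝ)
    (p : SphereTorusLine k l) (v w : ModelSpaceSTL k l) :
    warpedForm k l m ε f u p v w =
      stereoMetric k l (fun r => ε ^ 2 * f r ^ 2) (fun r => u r ^ (4 / (m : ℝ)))
        (extChartAt (modelSTL k l) p p) v w := by
  have h1 := pullbackForm_eq_inner_fderiv (p := p)
    ((contMDiff_line (k := k) (l := l)).mdifferentiable (by simp)) v w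
  have h2 := pullbackForm_eq_inner_fderiv (p := p)
    ((contMDiff_sphere_coe (k := k) (l := l)).mdifferentiable (by simp)) v w
  have h3 := fun i => pullbackForm_eq_inner_fderiv (p := p)
    ((contMDiff_circle_coe (k := k) (l := l) i).mdifferentiable (by simp)) v w
  refine (congrArg₂ (· + ·) (congrArg₂ (· + ·) h1 (congrArg _ h2))
    (congrArg _ (Finset.sum_congr rfl fun i _ => h3 i))).trans ?_
  simp only [fderiv_line_comp_extChartAt_symm, fderiv_sphere_comp_extChartAt_symm,
    fderiv_circle_comp_extChartAt_symm, ContinuousLinearMap.comp_apply,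
    inner_fderiv_stereographic'_symm, stereoMetric_apply, extChartAt_modelSTL_self_line,
    Finset.mul_sum, lineProj_apply, sphereProj_apply, circleProj_apply]
  exact congrArg₂ (· + ·) (congrArg₂ (· + ·) (by simp [mul_comm]) (by ring))
    (Finset.sum_congr rfl fun i _ => by ring)

theorem isBounded_stereoMetric_lt_one {P Q : ℝ → ℝ} (hP : ∀ r, 0 < P r) (hQ : ∀ r, 0 < Q r)
    (y : ModelSpaceSTL k l) :
    Bornology.IsBounded {v : ModelSpaceSTL k l | stereoMetric k l P Q y v v < 1} := by
  have ha : 0 < P y.2.2 * stereoFactor y.1 := mul_pos (hP _) (stereoFactor_pos _)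
  have hb : ∀ i, 0 < Q y.2.2 * stereoFactor (y.2.1 i) := fun i =>
    mul_pos (hQ _) (stereoFactor_pos _)
  -- `C` dominates the inverse of every diagonal coefficient and is at least 1, so c t² < 1 gives t²
  -- ≤ C ≤ C².
  set C : ℝ := 1 + (P y.2.2 * stereoFactor y.1)⁻¹ + ∑ i, (Q y.2.2 * stereoFactor (y.2.1 i))⁻¹
    with hC
  have hb0 : 0 ≤ ∑ i, (Q y.2.2 * stereoFactor (y.2.1 i))⁻¹ :=
    Finset.sum_nonneg fun i _ => (inv_pos.2 (hb i)).le
  have ha0 := inv_pos.2 ha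
  have hC1 : 1 ≤ C := by linarith
  have key : ∀ c t : ℝ, 0 < c → c⁻¹ ≤ C → 0 ≤ t → c * t ^ 2 < 1 → t ≤ C := by
    intro c t hc hcC ht hlt
    have h1 : t ^ 2 ≤ c⁻¹ := by
      rw [← one_div, le_div_iff₀ hc]; linarith
    nlinarith
  refine (Metric.isBounded_closedBall (x := (0 : ModelSpaceSTL k l)) (r := C)).subset fun v hv => ?_
  rw [Set.mem_ofPred_eq, stereoMetric_apply] at hv
  simp only [real_inner_self_eq_norm_sq] at hv
  have hvi : ∀ i, 0 ≤ Q y.2.2 * stereoFactor (y.2.1 i) * ‖v.2.1 i‖ ^ 2 := fun i =>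
    mul_nonneg (hb i).le (sq_nonneg _)
  have hvs : 0 ≤ P y.2.2 * stereoFactor y.1 * ‖v.1‖ ^ 2 := mul_nonneg ha.le (sq_nonneg _)
  have hsum := Finset.sum_nonneg (s := Finset.univ) fun i _ => hvi i
  have hr := mul_self_nonneg v.2.2
  rw [mem_closedBall_zero_iff, Prod.norm_def, Prod.norm_def]
  refine max_le (key _ _ ha (by linarith) (norm_nonneg _) (by linarith)) (max_le ?_ ?_)
  · refine (pi_norm_le_iff_of_nonneg (by linarith)).2 fun i => ?_
    have h1 := Finset.single_le_sum (f := fun i => (Q y.2.2 * stereoFactor (y.2.1 i))⁻¹)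
      (fun i _ => (inv_pos.2 (hb i)).le) (Finset.mem_univ i)
    have h2 := Finset.single_le_sum (fun i _ => hvi i) (Finset.mem_univ i)
    exact key _ _ (hb i) (by linarith) (norm_nonneg _) (by linarith)
  · refine key 1 _ one_pos (by simpa using hC1) (norm_nonneg _) ?_
    rw [Real.norm_eq_abs, sq_abs]
    nlinarith

/-- The warped metric `dr² + ε² f(r)² g_S + u(r)^(4/m) (dx_1² + ⋯ + dx_l²)`. -/
def warpedMetric (k l m : ℕ) {ε : ℝ} {f u : ℝ → ℝ} (hε : ε ≠ 0) (hf : ∀ r, 0 < f r)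
    (hu : ∀ r, 0 < u r) (hfs : ContDiff ℝ ∞ f) (hus : ContDiff ℝ ∞ u) :
    SmoothMetric (modelSTL k l) (SphereTorusLine k l) :=
  have hP : ∀ r, 0 < (fun r => ε ^ 2 * f r ^ 2) r := fun r => by have := hf r; positivity
  have hQ : ∀ r, 0 < (fun r => u r ^ (4 / (m : ℝ))) r := fun r => Real.rpow_pos_of_pos (hu r) _
  { inner := fun p => stereoMetric k l (fun r => ε ^ 2 * f r ^ 2) (fun r => u r ^ (4 / (m : ℝ)))
      (extChartAt (modelSTL k l) p p)
    symm := fun p v w => by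
      refine (stereoMetric_apply _ _ _ _ _).trans ((stereoMetric_apply _ _ _ _ _).trans ?_).symm
      simp only [real_inner_comm, mul_comm]
    pos := fun p v hv => stereoMetric_pos hP hQ _ _ hv
    isVonNBounded := fun p =>
      (NormedSpace.isVonNBounded_iff ℝ).2 (isBounded_stereoMetric_lt_one hP hQ _)
    contMDiff := by
      refine contMDiff_of_inChart_contDiff _
        (fun _ => stereoMetric k l (fun r => ε ^ 2 * f r ^ 2) (fun r => u r ^ (4 / (m : ℝ))))
        (fun _ => contDiff_stereoMetric (contDiff_const.mul (hfs.pow 2))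
          (hus.rpow_const_of_ne fun r => (hu r).ne')) fun p y _ v w => ?_
      exact (warpedForm_eq_stereoMetric m ε f u _ _ _).symm.trans
        (warpedForm_mfderiv_extChartAt_symm m ε f u p y v w) }

section

variable {m : ℕ} {ε : ℝ} {f u : ℝ → ℝ} (hε : ε ≠ 0) (hf : ∀ r, 0 < f r)
    (hu : ∀ r, 0 < u r) (hfs : ContDiff ℝ ∞ f) (hus : ContDiff ℝ ∞ u)

theorem warpedMetric_inner (p : SphereTorusLine k l) (v w : TangentSpace (modelSTL k l) p) :
    (warpedMetric k l m hε hf hu hfs hus).inner p v w = warpedForm k l m ε f u p v w :=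
  (warpedForm_eq_stereoMetric m ε f u p v w).symm

theorem warpedMetric_inChart (p : SphereTorusLine k l) :
    (warpedMetric k l m hε hf hu hfs hus).inChart p =
      stereoMetric k l (fun r => ε ^ 2 * f r ^ 2) (fun r => u r ^ (4 / (m : ℝ))) := by
  funext y
  refine ContinuousLinearMap.ext fun v => ContinuousLinearMap.ext fun w => ?_
  exact (warpedMetric_inner hε hf hu hfs hus _ _ _).trans
    (warpedForm_mfderiv_extChartAt_symm m ε f u p y v w)

theorem warpedMetric_isComplete : (warpedMetric k l m hε hf hu hfs hus).IsComplete := by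
  refine SmoothMetric.isComplete_of_proper _ (ρ := fun q => q.2.2)
    (contMDiff_line.of_le (by norm_cast)) (fun p v => ?_) fun a b => ?_
  · rw [warpedMetric_inner, warpedForm, add_assoc]
    refine le_add_of_nonneg_right (add_nonneg (mul_nonneg (by positivity) real_inner_self_nonneg)
      (mul_nonneg (Real.rpow_nonneg (hu _).le _)
        (Finset.sum_nonneg fun i _ => real_inner_self_nonneg)))
  · have : (fun q : SphereTorusLine k l => q.2.2) ⁻¹' Set.Icc a b =
        Set.univ ×ˢ (Set.univ ×ˢ Set.Icc a b) := by
      ext q; simp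
    rw [this]
    exact isCompact_univ.prod (isCompact_univ.prod isCompact_Icc)

end

end ProductChart

/-! ### Christoffel symbols of the round metric -/

section StereoGamma

variable {V : Type*} [NormedAddCommGroup V] [InnerProductSpace ℝ V]

/-- The Christoffel symbols of the round metric in stereographic coordinates. -/
def stereoGamma (x v w : V) : V :=
  (-(2 / (‖x‖ ^ 2 + 4))) • (inner ℝ x v • w + inner ℝ x w • v - inner ℝ v w • x)

@[simp] theorem stereoGamma_zero (v w : V) : stereoGamma 0 v w = 0 := by simp [stereoGamma]

/-- The derivative at `0` of the Christoffel symbols of the round metric. -/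
def stereoGammaDeriv (v w : V) : V →L[ℝ] V :=
  (-(1 / 2) : ℝ) • ((innerSL ℝ v).smulRight w + (innerSL ℝ w).smulRight v
    - inner ℝ v w • ContinuousLinearMap.id ℝ V)

theorem stereoGammaDeriv_apply (u v w : V) : stereoGammaDeriv v w u =
    (-(1 / 2) : ℝ) • (inner ℝ v u • w + inner ℝ w u • v - inner ℝ v w • u) := by
  simp [stereoGammaDeriv]

theorem hasFDerivAt_stereoGamma (v w : V) :
    HasFDerivAt (fun x => stereoGamma x v w) (stereoGammaDeriv v w) 0 := by
  -- The scalar factor is critical at 0 with value -1/2, so only the linear factor gets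
  -- differentiated.
  have hq : HasFDerivAt (fun x : V => -(2 / (‖x‖ ^ 2 + 4))) (0 : V →L[ℝ] ℝ) 0 := by
    have h : HasFDerivAt (fun x : V => ‖x‖ ^ 2 + 4) (2 • innerSL ℝ (0 : V)) 0 :=
      (hasStrictFDerivAt_norm_sq (0 : V)).hasFDerivAt.add_const 4
    have h2 := ((hasDerivAt_inv (x := ‖(0 : V)‖ ^ 2 + 4) (by positivity)).comp_hasFDerivAt (0 : V)
      h).const_mul (-2)
    refine (h2.congr_fderiv ?_).congr_of_eventuallyEq (Filter.Eventually.of_forall fun x => ?_)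
    · ext; simp
    · simp [div_eq_mul_inv]
  have hL := ((innerSL ℝ v).smulRight w + (innerSL ℝ w).smulRight v
    - inner ℝ v w • ContinuousLinearMap.id ℝ V).hasFDerivAt (x := (0 : V))
  refine ((hq.smul hL).congr_fderiv ?_).congr_of_eventuallyEq
    (Filter.Eventually.of_forall fun x => ?_)
  · ext u
    simp [stereoGammaDeriv]
    norm_num
  · simp [stereoGamma, real_inner_comm]

end StereoGamma

/-! ### Christoffel symbols and curvature of the warped metric -/

section ProductCurvature

variable {k l : ℕ} {P Q a b a' b' : ℝ → ℝ}

open ModelSpaceSTL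

/-- The sum of the inner products of the circle coordinates. -/
def circleInner (v w : ModelSpaceSTL k l) : ℝ := ∑ i, inner ℝ (v.2.1 i) (w.2.1 i)

theorem circleInner_comm (v w : ModelSpaceSTL k l) : circleInner v w = circleInner w v := by
  simp only [circleInner, real_inner_comm]

theorem circleInner_of_eq {x v w : ModelSpaceSTL k l} {α β : ℝ}
    (h : ∀ i, x.2.1 i = α • v.2.1 i + β • w.2.1 i) (z : ModelSpaceSTL k l) :
    circleInner x z = α * circleInner v z + β * circleInner w z := by
  simp only [circleInner, h, inner_add_left, real_inner_smul_left, Finset.sum_add_distrib,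
    Finset.mul_sum]

theorem circleInner_mk (x : EuclideanSpace ℝ (Fin k)) (r α β : ℝ) (v w z : ModelSpaceSTL k l) :
    circleInner ((x, fun i => α • v.2.1 i + β • w.2.1 i, r) : ModelSpaceSTL k l) z =
      α * circleInner v z + β * circleInner w z :=
  circleInner_of_eq (fun _ => rfl) z

/-- The form P' = 2 a P makes `a` the logarithmic derivative of the warping function √P, and keeps
each derivative a multiple of the coefficient itself. -/
theorem hasFDerivAt_mul_stereoFactor {V : Type*} [NormedAddCommGroup V] [InnerProductSpace ℝ V]
    (hP : ∀ r, HasDerivAt P (2 * a r * P r) r) (A : ModelSpaceSTL k l →L[ℝ] V)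
    (y : ModelSpaceSTL k l) :
    HasFDerivAt (fun y : ModelSpaceSTL k l => P y.2.2 * stereoFactor (A y))
      ((P y.2.2 * stereoFactor (A y)) • ((2 * a y.2.2) • lineProj k l
        - (4 / (‖A y‖ ^ 2 + 4)) • (innerSL ℝ (A y)).comp A)) y := by
  have hr : HasFDerivAt (fun y : ModelSpaceSTL k l => y.2.2) (lineProj k l) y :=
    (lineProj k l).hasFDerivAt
  have hS := HasFDerivAt.comp (g := stereoFactor) (f := A) y
    (hasFDerivAt_stereoFactor (A y)) A.hasFDerivAt
  refine (((hP y.2.2).comp_hasFDerivAt y hr).mul hS).congr_fderiv ?_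
  refine ContinuousLinearMap.ext fun u => ?_
  simp
  ring

theorem hasFDerivAt_stereoMetric (hP : ∀ r, HasDerivAt P (2 * a r * P r) r)
    (hQ : ∀ r, HasDerivAt Q (2 * b r * Q r) r) (y : ModelSpaceSTL k l) :
    HasFDerivAt (stereoMetric k l P Q)
      (((P y.2.2 * stereoFactor y.1) • ((2 * a y.2.2) • lineProj k l
          - (4 / (‖y.1‖ ^ 2 + 4)) • (innerSL ℝ y.1).comp (sphereProj k l))).smulRight
          (pullbackInner (sphereProj k l))
        + ∑ i, ((Q y.2.2 * stereoFactor (y.2.1 i)) • ((2 * b y.2.2) • lineProj k l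
          - (4 / (‖y.2.1 i‖ ^ 2 + 4)) • (innerSL ℝ (y.2.1 i)).comp (circleProj k l i))).smulRight
          (pullbackInner (circleProj k l i))) y := by
  have h := (((hasFDerivAt_mul_stereoFactor hP (sphereProj k l) y).smul_const
    (pullbackInner (sphereProj k l))).const_add (pullbackInner (lineProj k l))).add
    (HasFDerivAt.fun_sum (u := Finset.univ) fun i _ =>
      (hasFDerivAt_mul_stereoFactor hQ (circleProj k l i) y).smul_const
        (pullbackInner (circleProj k l i)))
  exact h

theorem fderiv_stereoMetric_apply (hP : ∀ r, HasDerivAt P (2 * a r * P r) r)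
    (hQ : ∀ r, HasDerivAt Q (2 * b r * Q r) r) (y u v w : ModelSpaceSTL k l) :
    fderiv ℝ (stereoMetric k l P Q) y u v w =
      P y.2.2 * stereoFactor y.1 *
          (2 * a y.2.2 * u.2.2 - 4 / (‖y.1‖ ^ 2 + 4) * inner ℝ y.1 u.1) * inner ℝ v.1 w.1
        + ∑ i, Q y.2.2 * stereoFactor (y.2.1 i) *
          (2 * b y.2.2 * u.2.2 - 4 / (‖y.2.1 i‖ ^ 2 + 4) * inner ℝ (y.2.1 i) (u.2.1 i)) *
            inner ℝ (v.2.1 i) (w.2.1 i) := by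
  rw [(hasFDerivAt_stereoMetric hP hQ y).fderiv]
  simp only [add_apply, sum_apply, ContinuousLinearMap.smulRight_apply, smul_apply, sub_apply,
    ContinuousLinearMap.comp_apply, innerSL_apply_apply, pullbackInner_apply, lineProj_apply,
    sphereProj_apply, circleProj_apply, smul_eq_mul]

/-- The Christoffel symbols of `dr² + P(r) g_S + Q(r) (dx_1² + ⋯ + dx_l²)`, with `P' = 2 a P` and
`Q' = 2 b Q`, in stereographic coordinates. -/
def stereoChristoffel (P Q a b : ℝ → ℝ) (y v w : ModelSpaceSTL k l) : ModelSpaceSTL k l :=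
  (a y.2.2 • (v.2.2 • w.1 + w.2.2 • v.1) + stereoGamma y.1 v.1 w.1,
    fun i => b y.2.2 • (v.2.2 • w.2.1 i + w.2.2 • v.2.1 i)
      + stereoGamma (y.2.1 i) (v.2.1 i) (w.2.1 i),
    -(a y.2.2 * P y.2.2 * stereoFactor y.1 * inner ℝ v.1 w.1
      + ∑ i, b y.2.2 * Q y.2.2 * stereoFactor (y.2.1 i) * inner ℝ (v.2.1 i) (w.2.1 i)))

/-- This is the Koszul formula. It separates into one identity for the sphere and one for each
circle, the line component being shared out among them. -/
theorem stereoMetric_stereoChristoffel (hP : ∀ r, HasDerivAt P (2 * a r * P r) r)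
    (hQ : ∀ r, HasDerivAt Q (2 * b r * Q r) r) (y v w z : ModelSpaceSTL k l) :
    stereoMetric k l P Q y (stereoChristoffel P Q a b y v w) z =
      1 / 2 * (fderiv ℝ (stereoMetric k l P Q) y v w z + fderiv ℝ (stereoMetric k l P Q) y w v z
        - fderiv ℝ (stereoMetric k l P Q) y z v w) := by
  simp only [fderiv_stereoMetric_apply hP hQ, stereoMetric_apply, stereoChristoffel, stereoGamma,
    inner_add_left, real_inner_smul_left, inner_sub_left, neg_mul, add_mul, Finset.sum_mul]
  have e : ∀ (A B C D E F : ℝ), 1 / 2 * (A + B + (C + D) - (E + F)) =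
    1 / 2 * (A + C - E) + 1 / 2 * (B + D - F) := fun _ _ _ _ _ _ => by ring
  rw [e, ← Finset.sum_add_distrib, ← Finset.sum_sub_distrib, Finset.mul_sum]
  have e' : ∀ (A B C D : ℝ), -(A + B) + C + D = (C - A) + (D - B) := fun _ _ _ _ => by ring
  rw [e', ← Finset.sum_sub_distrib]
  refine congrArg₂ (· + ·) ?_ (Finset.sum_congr rfl fun i _ => ?_)
  · have : ‖y.1‖ ^ 2 + 4 ≠ 0 := by positivity
    field_simp
    ring
  · have : ‖y.2.1 i‖ ^ 2 + 4 ≠ 0 := by positivity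
    field_simp
    ring

/-- A nondegenerate bilinear form on a finite-dimensional space is inverted by
`ContinuousLinearMap.inverse`. -/
theorem ContinuousLinearMap.inverse_apply_eq_of_injective {E : Type*} [NormedAddCommGroup E]
    [NormedSpace ℝ E] [FiniteDimensional ℝ E] {B : E →L[ℝ] E →L[ℝ] ℝ}
    (hB : Function.Injective B) {x : E} {φ : E →L[ℝ] ℝ} (h : B x = φ) : B.inverse φ = x := by
  have hd : Module.finrank ℝ E = Module.finrank ℝ (E →L[ℝ] ℝ) := by
    rw [← (LinearMap.toContinuousLinearMap (𝕜 := ℝ) (E := E) (F' := ℝ)).finrank_eq]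
    exact Subspace.dual_finrank_eq.symm
  let e : E ≃L[ℝ] (E →L[ℝ] ℝ) :=
    (LinearEquiv.ofInjectiveOfFinrankEq B.toLinearMap hB hd).toContinuousLinearEquiv
  have he : B = (e : E →L[ℝ] (E →L[ℝ] ℝ)) := by ext; rfl
  rw [he, ContinuousLinearMap.inverse_equiv]
  rw [← h, he]
  exact e.symm_apply_apply x

theorem christoffel_eq_stereoChristoffel {g : SmoothMetric (modelSTL k l) (SphereTorusLine k l)}
    {p : SphereTorusLine k l} (hg : g.inChart p = stereoMetric k l P Q)
    (hP0 : ∀ r, 0 < P r) (hQ0 : ∀ r, 0 < Q r)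
    (hP : ∀ r, HasDerivAt P (2 * a r * P r) r) (hQ : ∀ r, HasDerivAt Q (2 * b r * Q r) r)
    (y v w : ModelSpaceSTL k l) : g.christoffel p y v w = stereoChristoffel P Q a b y v w := by
  unfold SmoothMetric.christoffel
  rw [hg]
  refine ContinuousLinearMap.inverse_apply_eq_of_injective ?_ ?_
  · refine (injective_iff_map_eq_zero _).2 fun x hx => ?_
    by_contra hne
    have := stereoMetric_pos hP0 hQ0 y x hne
    rw [hx] at this
    exact lt_irrefl _ this
  · refine ContinuousLinearMap.ext fun z => ?_
    rw [stereoMetric_stereoChristoffel hP hQ]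
    unfold SmoothMetric.christoffelLower
    rw [hg]
    rfl

/-- At the centre the conformal factors equal 1 and have zero derivative, so only the warping
functions and the linear part of `stereoGamma` contribute; (a P)' = (a' + 2 a²) P. -/
theorem fderiv_stereoChristoffel_apply (hP : ∀ r, HasDerivAt P (2 * a r * P r) r)
    (hQ : ∀ r, HasDerivAt Q (2 * b r * Q r) r) (ha : ∀ r, HasDerivAt a (a' r) r)
    (hb : ∀ r, HasDerivAt b (b' r) r) {y : ModelSpaceSTL k l} (hy1 : y.1 = 0)
    (hy2 : ∀ i, y.2.1 i = 0) (u v w : ModelSpaceSTL k l) :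
    fderiv ℝ (fun z => stereoChristoffel P Q a b z v w) y u =
      ((a' y.2.2 * u.2.2) • (v.2.2 • w.1 + w.2.2 • v.1) + stereoGammaDeriv v.1 w.1 u.1,
        fun i => (b' y.2.2 * u.2.2) • (v.2.2 • w.2.1 i + w.2.2 • v.2.1 i)
          + stereoGammaDeriv (v.2.1 i) (w.2.1 i) (u.2.1 i),
        -((a' y.2.2 + 2 * a y.2.2 ^ 2) * P y.2.2 * u.2.2 * inner ℝ v.1 w.1
          + (b' y.2.2 + 2 * b y.2.2 ^ 2) * Q y.2.2 * u.2.2 * circleInner v w)) := by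
  have hr : HasFDerivAt (fun y : ModelSpaceSTL k l => y.2.2) (lineProj k l) y :=
    (lineProj k l).hasFDerivAt
  have hc0 : stereoFactor (0 : EuclideanSpace ℝ (Fin k)) = 1 := by norm_num [stereoFactor]
  have hc1 : stereoFactor (0 : EuclideanSpace ℝ (Fin 1)) = 1 := by norm_num [stereoFactor]
  have hS : HasFDerivAt (fun y : ModelSpaceSTL k l => stereoFactor y.1)
      (0 : ModelSpaceSTL k l →L[ℝ] ℝ) y := by
    have := HasFDerivAt.comp (g := stereoFactor) (f := sphereProj k l) y
      (hasFDerivAt_stereoFactor y.1) (sphereProj k l).hasFDerivAt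
    refine this.congr_fderiv ?_
    rw [hy1]; simp
  have hT : ∀ i, HasFDerivAt (fun y : ModelSpaceSTL k l => stereoFactor (y.2.1 i))
      (0 : ModelSpaceSTL k l →L[ℝ] ℝ) y := fun i => by
    have := HasFDerivAt.comp (g := stereoFactor) (f := circleProj k l i) y
      (hasFDerivAt_stereoFactor (y.2.1 i)) (circleProj k l i).hasFDerivAt
    refine this.congr_fderiv ?_
    rw [hy2]; simp
  have hGS : HasFDerivAt (fun y : ModelSpaceSTL k l => stereoGamma y.1 v.1 w.1)
      ((stereoGammaDeriv v.1 w.1).comp (sphereProj k l)) y :=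
    HasFDerivAt.comp (g := fun x => stereoGamma x v.1 w.1) (f := sphereProj k l) y
      (by rw [sphereProj_apply, hy1]; exact hasFDerivAt_stereoGamma _ _)
      (sphereProj k l).hasFDerivAt
  have hGT : ∀ i, HasFDerivAt (fun y : ModelSpaceSTL k l =>
      stereoGamma (y.2.1 i) (v.2.1 i) (w.2.1 i))
      ((stereoGammaDeriv (v.2.1 i) (w.2.1 i)).comp (circleProj k l i)) y := fun i =>
    HasFDerivAt.comp (g := fun x => stereoGamma x (v.2.1 i) (w.2.1 i)) (f := circleProj k l i) y
      (by rw [circleProj_apply, hy2]; exact hasFDerivAt_stereoGamma _ _)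
      (circleProj k l i).hasFDerivAt
  have har := (ha y.2.2).comp_hasFDerivAt y hr
  have hbr := (hb y.2.2).comp_hasFDerivAt y hr
  have hPr := (hP y.2.2).comp_hasFDerivAt y hr
  have hQr := (hQ y.2.2).comp_hasFDerivAt y hr
  have h1 := (har.smul_const (v.2.2 • w.1 + w.2.2 • v.1)).add hGS
  have h2 := hasFDerivAt_pi.2 fun i =>
    (hbr.smul_const (v.2.2 • w.2.1 i + w.2.2 • v.2.1 i)).add (hGT i)
  have h3 := ((((har.mul hPr).mul hS).mul_const (inner ℝ v.1 w.1)).add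
    (HasFDerivAt.fun_sum (u := Finset.univ) fun i _ =>
      ((hbr.mul hQr).mul (hT i)).mul_const (inner ℝ (v.2.1 i) (w.2.1 i)))).neg
  have h : HasFDerivAt (fun z => stereoChristoffel P Q a b z v w) _ y := h1.prodMk (h2.prodMk h3)
  rw [h.fderiv]
  refine Prod.ext ?_ (Prod.ext ?_ ?_)
  · simp
  · funext i
    simp
  · simp [hy1, hy2, hc0, hc1, circleInner, Finset.mul_sum]
    exact congrArg₂ (· + ·) (congrArg _ (Finset.sum_congr rfl fun i _ => by ring)) (by ring)

theorem stereoChristoffel_center {y : ModelSpaceSTL k l} (hy1 : y.1 = 0)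
    (hy2 : ∀ i, y.2.1 i = 0) (v w : ModelSpaceSTL k l) :
    stereoChristoffel P Q a b y v w =
      (a y.2.2 • (v.2.2 • w.1 + w.2.2 • v.1),
        fun i => b y.2.2 • (v.2.2 • w.2.1 i + w.2.2 • v.2.1 i),
        -(a y.2.2 * P y.2.2 * inner ℝ v.1 w.1 + b y.2.2 * Q y.2.2 * circleInner v w)) := by
  have hc0 : stereoFactor (0 : EuclideanSpace ℝ (Fin k)) = 1 := by norm_num [stereoFactor]
  have hc1 : stereoFactor (0 : EuclideanSpace ℝ (Fin 1)) = 1 := by norm_num [stereoFactor]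
  simp [stereoChristoffel, hy1, hy2, hc0, hc1, circleInner, Finset.mul_sum]

theorem stereoMetric_center {y : ModelSpaceSTL k l} (hy1 : y.1 = 0)
    (hy2 : ∀ i, y.2.1 i = 0) (v w : ModelSpaceSTL k l) :
    stereoMetric k l P Q y v w =
      v.2.2 * w.2.2 + P y.2.2 * inner ℝ v.1 w.1 + Q y.2.2 * circleInner v w := by
  have hc0 : stereoFactor (0 : EuclideanSpace ℝ (Fin k)) = 1 := by norm_num [stereoFactor]
  have hc1 : stereoFactor (0 : EuclideanSpace ℝ (Fin 1)) = 1 := by norm_num [stereoFactor]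
  simp [stereoMetric_apply, hy1, hy2, hc0, hc1, circleInner, Finset.mul_sum]

/-- Vectors of a line are proportional. This is what makes the circles flat, although their
coordinates are stereographic like those of the sphere. -/
theorem inner_self_smul_eq_of_fin_one (v w : EuclideanSpace ℝ (Fin 1)) :
    inner ℝ w w • v = inner ℝ v w • w := by
  ext i
  fin_cases i
  simp only [PiLp.inner_apply, Finset.univ_unique, Finset.sum_singleton, PiLp.smul_apply,
    smul_eq_mul, RCLike.inner_apply, conj_trivial]
  simp
  ring

/-- The curvature of `dr² + P(r) g_S + Q(r) (dx_1² + ⋯ + dx_l²)` at the centre of the chart. -/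
theorem curvatureInChart_center
    {g : SmoothMetric (modelSTL k l) (SphereTorusLine k l)}
    {p : SphereTorusLine k l} (hg : g.inChart p = stereoMetric k l P Q)
    (hP0 : ∀ r, 0 < P r) (hQ0 : ∀ r, 0 < Q r)
    (hP : ∀ r, HasDerivAt P (2 * a r * P r) r) (hQ : ∀ r, HasDerivAt Q (2 * b r * Q r) r)
    (ha : ∀ r, HasDerivAt a (a' r) r) (hb : ∀ r, HasDerivAt b (b' r) r)
    {y : ModelSpaceSTL k l} (hy1 : y.1 = 0) (hy2 : ∀ i, y.2.1 i = 0)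
    (v w : ModelSpaceSTL k l) :
    g.curvatureInChart p y v w w =
      ((-(a' y.2.2 + a y.2.2 ^ 2) * w.2.2 ^ 2 + inner ℝ w.1 w.1
          - a y.2.2 * (a y.2.2 * P y.2.2 * inner ℝ w.1 w.1
            + b y.2.2 * Q y.2.2 * circleInner w w)) • v.1
        + ((a' y.2.2 + a y.2.2 ^ 2) * (v.2.2 * w.2.2) - inner ℝ v.1 w.1
          + a y.2.2 * (a y.2.2 * P y.2.2 * inner ℝ v.1 w.1
            + b y.2.2 * Q y.2.2 * circleInner v w)) • w.1,
      fun i => (-(b' y.2.2 + b y.2.2 ^ 2) * w.2.2 ^ 2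
          - b y.2.2 * (a y.2.2 * P y.2.2 * inner ℝ w.1 w.1
            + b y.2.2 * Q y.2.2 * circleInner w w)) • v.2.1 i
        + ((b' y.2.2 + b y.2.2 ^ 2) * (v.2.2 * w.2.2)
          + b y.2.2 * (a y.2.2 * P y.2.2 * inner ℝ v.1 w.1
            + b y.2.2 * Q y.2.2 * circleInner v w)) • w.2.1 i,
      -v.2.2 * ((a' y.2.2 + a y.2.2 ^ 2) * P y.2.2 * inner ℝ w.1 w.1
          + (b' y.2.2 + b y.2.2 ^ 2) * Q y.2.2 * circleInner w w)
        + w.2.2 * ((a' y.2.2 + a y.2.2 ^ 2) * P y.2.2 * inner ℝ v.1 w.1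
          + (b' y.2.2 + b y.2.2 ^ 2) * Q y.2.2 * circleInner v w)) := by
  have hΓ : ∀ v w, (fun z => g.christoffel p z v w) = fun z => stereoChristoffel P Q a b z v w :=
    fun v w => funext fun z => christoffel_eq_stereoChristoffel hg hP0 hQ0 hP hQ z v w
  have hΓy : ∀ v w, g.christoffel p y v w = stereoChristoffel P Q a b y v w :=
    fun v w => christoffel_eq_stereoChristoffel hg hP0 hQ0 hP hQ y v w
  unfold SmoothMetric.curvatureInChart
  rw [hΓ, hΓ, hΓy, hΓy, hΓy, hΓy, fderiv_stereoChristoffel_apply hP hQ ha hb hy1 hy2,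
    fderiv_stereoChristoffel_apply hP hQ ha hb hy1 hy2]
  -- The inner symbols of Γ(v, Γ(w, w)) and Γ(w, Γ(v, w)) are named, so that only their components
  -- enter the outer ones.
  set ww := stereoChristoffel P Q a b y w w with hww
  set vw := stereoChristoffel P Q a b y v w with hvw
  rw [stereoChristoffel_center hy1 hy2] at hww hvw
  rw [stereoChristoffel_center hy1 hy2, stereoChristoffel_center hy1 hy2]
  have hww1 : ww.1 = a y.2.2 • (w.2.2 • w.1 + w.2.2 • w.1) := by rw [hww]
  have hvw1 : vw.1 = a y.2.2 • (v.2.2 • w.1 + w.2.2 • v.1) := by rw [hvw]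
  have hww2 : ∀ i, ww.2.1 i = b y.2.2 • (w.2.2 • w.2.1 i + w.2.2 • w.2.1 i) := by rw [hww]; simp
  have hvw2 : ∀ i, vw.2.1 i = b y.2.2 • (v.2.2 • w.2.1 i + w.2.2 • v.2.1 i) := by rw [hvw]; simp
  have hwwr : ww.2.2 = -(a y.2.2 * P y.2.2 * inner ℝ w.1 w.1
      + b y.2.2 * Q y.2.2 * circleInner w w) := by rw [hww]
  have hvwr : vw.2.2 = -(a y.2.2 * P y.2.2 * inner ℝ v.1 w.1
      + b y.2.2 * Q y.2.2 * circleInner v w) := by rw [hvw]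
  have hwwT : circleInner v ww = 2 * b y.2.2 * w.2.2 * circleInner v w := by
    rw [circleInner_comm, circleInner_of_eq (v := w) (w := w) (α := b y.2.2 * w.2.2)
      (β := b y.2.2 * w.2.2) (fun i => by rw [hww2]; module), circleInner_comm w v]
    ring
  have hvwT : circleInner w vw = b y.2.2 * (v.2.2 * circleInner w w + w.2.2 * circleInner v w) := by
    rw [circleInner_comm, circleInner_of_eq (v := w) (w := v) (α := b y.2.2 * v.2.2)
      (β := b y.2.2 * w.2.2) (fun i => by rw [hvw2]; module)]
    ring
  have hwwS : inner ℝ v.1 ww.1 = 2 * a y.2.2 * w.2.2 * inner ℝ v.1 w.1 := by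
    rw [hww1]; simp only [inner_add_right, real_inner_smul_right]; ring
  have hvwS : inner ℝ w.1 vw.1 = a y.2.2 * (v.2.2 * inner ℝ w.1 w.1 + w.2.2 * inner ℝ v.1 w.1) := by
    rw [hvw1]; simp only [inner_add_right, real_inner_smul_right]
    rw [real_inner_comm v.1 w.1]
  refine Prod.ext ?_ (Prod.ext (funext fun i => ?_) ?_)
  · simp only [Prod.fst_add, Prod.fst_sub, stereoGammaDeriv_apply, hww1, hvw1, hwwr, hvwr]
    rw [real_inner_comm v.1 w.1]
    module
  -- The intrinsic curvature term of the circle cancels by proportionality.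
  · have h1 := inner_self_smul_eq_of_fin_one (v.2.1 i) (w.2.1 i)
    simp only [Prod.fst_add, Prod.snd_add, Prod.fst_sub, Prod.snd_sub, Pi.add_apply, Pi.sub_apply,
      stereoGammaDeriv_apply, hww2, hvw2, hwwr, hvwr]
    rw [real_inner_comm (v.2.1 i) (w.2.1 i)]
    linear_combination (norm := module) h1
  · simp only [Prod.snd_add, Prod.snd_sub, hwwT, hvwT, hwwS, hvwS]
    ring

/-- Each block of planes enters through its part of the Gram determinant of `v`, `w`, times one
eigenvalue: this is the diagonal form of the curvature operator. The flat torus lacks the term 1 /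
Q. -/
theorem stereoMetric_curvatureInChart
    {g : SmoothMetric (modelSTL k l) (SphereTorusLine k l)}
    {p : SphereTorusLine k l} (hg : g.inChart p = stereoMetric k l P Q)
    (hP0 : ∀ r, 0 < P r) (hQ0 : ∀ r, 0 < Q r)
    (hP : ∀ r, HasDerivAt P (2 * a r * P r) r) (hQ : ∀ r, HasDerivAt Q (2 * b r * Q r) r)
    (ha : ∀ r, HasDerivAt a (a' r) r) (hb : ∀ r, HasDerivAt b (b' r) r)
    {y : ModelSpaceSTL k l} (hy1 : y.1 = 0) (hy2 : ∀ i, y.2.1 i = 0)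
    (v w : ModelSpaceSTL k l) :
    stereoMetric k l P Q y (g.curvatureInChart p y v w w) v =
      -(a' y.2.2 + a y.2.2 ^ 2) * P y.2.2 * (inner ℝ v.1 v.1 * w.2.2 ^ 2
          + inner ℝ w.1 w.1 * v.2.2 ^ 2 - 2 * inner ℝ v.1 w.1 * (v.2.2 * w.2.2))
        - (b' y.2.2 + b y.2.2 ^ 2) * Q y.2.2 * (circleInner v v * w.2.2 ^ 2
          + circleInner w w * v.2.2 ^ 2 - 2 * circleInner v w * (v.2.2 * w.2.2))
        + (1 / P y.2.2 - a y.2.2 ^ 2) * P y.2.2 ^ 2 *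
          (inner ℝ v.1 v.1 * inner ℝ w.1 w.1 - inner ℝ v.1 w.1 ^ 2)
        - a y.2.2 * b y.2.2 * P y.2.2 * Q y.2.2 * (inner ℝ v.1 v.1 * circleInner w w
          + inner ℝ w.1 w.1 * circleInner v v - 2 * inner ℝ v.1 w.1 * circleInner v w)
        - b y.2.2 ^ 2 * Q y.2.2 ^ 2 *
          (circleInner v v * circleInner w w - circleInner v w ^ 2) := by
  rw [curvatureInChart_center hg hP0 hQ0 hP hQ ha hb hy1 hy2, stereoMetric_center hy1 hy2,
    circleInner_mk]
  have hPne := (hP0 y.2.2).ne'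
  simp only [inner_add_left, real_inner_smul_left]
  rw [real_inner_comm v.1 w.1, circleInner_comm w v]
  field_simp
  ring

end ProductCurvature

/-! ### Minimising a diagonal curvature operator over orthonormal frames -/

section FrameAlgebra

theorem sum_sum_sum_sum_comm {A B C D : Type*} [Fintype A] [Fintype B] [Fintype C] [Fintype D]
    (F : A → B → C → D → ℝ) :
    ∑ a, ∑ b, ∑ c, ∑ d, F a b c d = ∑ c, ∑ d, ∑ a, ∑ b, F a b c d := by
  have h : ∑ x : A × B, ∑ y : C × D, F x.1 x.2 y.1 y.2 =
      ∑ y : C × D, ∑ x : A × B, F x.1 x.2 y.1 y.2 := Finset.sum_comm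
  simpa only [Fintype.sum_prod_type] using h

theorem sum_sum_mul_minor_sq {A : Type*} [Fintype A] (α β x y : A → ℝ) :
    ∑ a, ∑ b, α a * β b * (x a * y b - y a * x b) ^ 2 =
      (∑ a, α a * (x a * x a)) * (∑ b, β b * (y b * y b))
        + (∑ a, α a * (y a * y a)) * (∑ b, β b * (x b * x b))
        - 2 * ((∑ a, α a * (x a * y a)) * (∑ b, β b * (x b * y b))) := by
  rw [Finset.sum_mul_sum, Finset.sum_mul_sum, Finset.sum_mul_sum]
  simp only [Finset.mul_sum, ← Finset.sum_add_distrib, ← Finset.sum_sub_distrib]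
  exact Finset.sum_congr rfl fun a _ => Finset.sum_congr rfl fun b _ => by ring

/-- A sum over the pairs `a < b` with `a < m`, by inclusion and exclusion. -/
theorem sum_sum_ite_lt {N m : ℕ} (g : Fin N → Fin N → ℝ) (hs : ∀ a b, g a b = g b a)
    (h0 : ∀ a, g a a = 0) {χ : Fin N → ℝ} (hχ : ∀ a, χ a = if (a : ℕ) < m then 1 else 0) :
    ∑ a : Fin N, ∑ b : Fin N, (if (a : ℕ) < m ∧ a < b then g a b else 0) =
      ∑ a : Fin N, ∑ b : Fin N, χ a * 1 * g a b
        - 1 / 2 * ∑ a : Fin N, ∑ b : Fin N, χ a * χ b * g a b := by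
  have h1 : ∑ a : Fin N, ∑ b : Fin N, (if (a : ℕ) < m ∧ a < b then g a b else 0) =
      ∑ a : Fin N, ∑ b : Fin N, (if (b : ℕ) < m ∧ b < a then g a b else 0) := by
    rw [Finset.sum_comm]
    exact Finset.sum_congr rfl fun a _ => Finset.sum_congr rfl fun b _ => by rw [hs b a]
  have h2 : ∑ a : Fin N, ∑ b : Fin N, χ a * 1 * g a b = ∑ a : Fin N, ∑ b : Fin N, χ b * g a b := by
    rw [Finset.sum_comm]
    exact Finset.sum_congr rfl fun a _ => Finset.sum_congr rfl fun b _ => by rw [hs b a, mul_one]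
  have h3 : ∀ a b : Fin N, (if (a : ℕ) < m ∧ a < b then g a b else 0)
      + (if (b : ℕ) < m ∧ b < a then g a b else 0) =
      χ a * 1 * g a b + χ b * g a b - χ a * χ b * g a b := by
    intro a b
    rw [hχ, hχ]
    rcases lt_trichotomy a b with h | rfl | h
    · have h' : (a : ℕ) < b := h
      have hn : ¬ b < a := not_lt.2 h.le
      by_cases ha : (a : ℕ) < m <;> by_cases hb : (b : ℕ) < m <;> simp [h, hn, ha, hb]
      omega
    · simp [h0]
    · have h' : (b : ℕ) < a := h
      have hn : ¬ a < b := not_lt.2 h.le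
      by_cases ha : (a : ℕ) < m <;> by_cases hb : (b : ℕ) < m <;> simp [h, hn, ha, hb]
      omega
  have h4 : ∑ a : Fin N, ∑ b : Fin N, ((if (a : ℕ) < m ∧ a < b then g a b else 0)
      + (if (b : ℕ) < m ∧ b < a then g a b else 0)) =
      ∑ a : Fin N, ∑ b : Fin N, (χ a * 1 * g a b + χ b * g a b - χ a * χ b * g a b) :=
    Finset.sum_congr rfl fun a _ => Finset.sum_congr rfl fun b _ => h3 a b
  simp only [Finset.sum_add_distrib, Finset.sum_sub_distrib] at h4
  linarith

variable {J : Type*} {N m : ℕ}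

/-- The entries of the orthogonal projection to the span of the first `m` vectors of a frame. -/
def frameProj (m : ℕ) (X : Fin N → J → ℝ) (i j : J) : ℝ :=
  ∑ a : Fin N, (if (a : ℕ) < m then 1 else 0) * (X a i * X a j)

/-- The sum over `a < b` with `a < m` of the squared `(i, j)`-minors of a frame. -/
def frameMinor (m : ℕ) (X : Fin N → J → ℝ) (i j : J) : ℝ :=
  ∑ a : Fin N, ∑ b : Fin N,
    if (a : ℕ) < m ∧ a < b then (X a i * X b j - X a j * X b i) ^ 2 else 0

variable {X : Fin N → J → ℝ}

theorem frameProj_comm (i j : J) : frameProj m X i j = frameProj m X j i := by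
  simp only [frameProj, mul_comm (X _ i)]

theorem frameProj_self_nonneg (i : J) : 0 ≤ frameProj m X i i :=
  Finset.sum_nonneg fun a _ => mul_nonneg (by split_ifs <;> norm_num) (mul_self_nonneg _)

theorem frameMinor_self (i : J) : frameMinor m X i i = 0 := by
  simp [frameMinor]

variable [Fintype J]

theorem sum_frameProj_self (hm : m ≤ N)
    (hX : ∀ a b, ∑ j, X a j * X b j = if a = b then 1 else 0) :
    ∑ i, frameProj m X i i = m := by
  simp only [frameProj]
  rw [Finset.sum_comm]
  simp only [← Finset.mul_sum, hX, if_true, mul_one]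
  rw [Finset.sum_boole]
  norm_cast
  rw [Fin.card_filter_val_lt]
  exact min_eq_right hm

/-- A diagonal entry of Π² = Π for the symmetric projection matrix Π. -/
theorem sum_frameProj_sq (hX : ∀ a b, ∑ j, X a j * X b j = if a = b then 1 else 0) (i : J) :
    ∑ j, frameProj m X i j ^ 2 = frameProj m X i i := by
  have h : ∀ j, frameProj m X i j ^ 2 = ∑ a : Fin N, ∑ b : Fin N,
      ((if (a : ℕ) < m then 1 else 0) * X a i * ((if (b : ℕ) < m then 1 else 0) * X b i)) *
        (X a j * X b j) := by
    intro j
    rw [sq, frameProj, Finset.sum_mul_sum]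
    exact Finset.sum_congr rfl fun a _ => Finset.sum_congr rfl fun b _ => by ring
  simp only [h]
  rw [Finset.sum_comm]
  refine Finset.sum_congr rfl fun a _ => ?_
  rw [Finset.sum_comm]
  simp only [← Finset.mul_sum, hX]
  rw [Finset.sum_eq_single a (fun b _ hb => by rw [if_neg hb.symm, mul_zero])
    (fun h => absurd (Finset.mem_univ a) h), if_pos rfl]
  split_ifs <;> ring

theorem frameProj_self_le_one (hX : ∀ a b, ∑ j, X a j * X b j = if a = b then 1 else 0) (i : J) :
    frameProj m X i i ≤ 1 := by
  have h : frameProj m X i i ^ 2 ≤ frameProj m X i i :=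
    (Finset.single_le_sum (f := fun j => frameProj m X i j ^ 2) (fun _ _ => sq_nonneg _)
      (Finset.mem_univ i)).trans_eq (sum_frameProj_sq hX i)
  by_contra hc
  nlinarith

variable [DecidableEq J]

theorem frame_columns_orthonormal (hN : N = Fintype.card J)
    (hX : ∀ a b, ∑ j, X a j * X b j = if a = b then 1 else 0) (i j : J) :
    ∑ a, X a i * X a j = if i = j then 1 else 0 := by
  have h1 : (Matrix.of X) * (Matrix.of X).transpose = 1 := by
    ext a b
    simp [Matrix.mul_apply, hX, Matrix.one_apply]
  have h2 := (Matrix.mul_eq_one_comm_of_card_eq _ _ _ (by rw [Fintype.card_fin, hN])).1 h1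
  have h3 := congrFun (congrFun h2 i) j
  simpa [Matrix.mul_apply, Matrix.one_apply] using h3

/-- Inclusion and exclusion reduces to unrestricted sums over frame vectors, where orthonormality of
the columns of a square matrix with orthonormal rows removes the mixed term. -/
theorem frameMinor_eq (hN : N = Fintype.card J)
    (hX : ∀ a b, ∑ j, X a j * X b j = if a = b then 1 else 0) {i j : J} (hij : i ≠ j) :
    frameMinor m X i j = frameProj m X i i + frameProj m X j j
      - frameProj m X i i * frameProj m X j j + frameProj m X i j ^ 2 := by
  unfold frameMinor
  rw [sum_sum_ite_lt (fun a b => (X a i * X b j - X a j * X b i) ^ 2) (fun a b => by ring)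
    (fun a => by ring) (fun a => rfl), sum_sum_mul_minor_sq _ (fun _ => 1) (fun a => X a i)
    (fun a => X a j), sum_sum_mul_minor_sq _ _ (fun a => X a i) (fun a => X a j)]
  simp only [one_mul, frame_columns_orthonormal hN hX, if_true, if_neg hij]
  change frameProj m X i i * 1 + frameProj m X j j * 1 - 2 * (frameProj m X i j * 0)
    - 1 / 2 * (frameProj m X i i * frameProj m X j j + frameProj m X j j * frameProj m X i i
      - 2 * (frameProj m X i j * frameProj m X i j)) = _
  ring

theorem frameProj_sq_add_sq_le (hX : ∀ a b, ∑ j, X a j * X b j = if a = b then 1 else 0)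
    {i j : J} (hij : i ≠ j) :
    frameProj m X i j ^ 2 + frameProj m X i i ^ 2 ≤ frameProj m X i i := by
  have h := sum_frameProj_sq (m := m) hX i
  calc _ = ∑ q ∈ {j, i}, frameProj m X i q ^ 2 := by rw [Finset.sum_pair hij.symm]
    _ ≤ ∑ q, frameProj m X i q ^ 2 :=
        Finset.sum_le_sum_of_subset_of_nonneg (Finset.subset_univ _) fun _ _ _ => sq_nonneg _
    _ = _ := h

/-- If the curvature operator is diagonal in orthonormal coordinates indexed by `S ⊕ O`, with
a large eigenvalue `κ` on the planes of `S`, then the intermediate curvature is minimal at the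
span of the coordinates of `O`. -/
theorem le_sum_frame_of_diagonal {S O : Type*} [Fintype S] [Fintype O] [DecidableEq S]
    [DecidableEq O] (hN : N = Fintype.card S + Fintype.card O) (hm : m = Fintype.card O)
    (hS : 2 ≤ Fintype.card S) {X : Fin N → S ⊕ O → ℝ}
    (hX : ∀ a b, ∑ j, X a j * X b j = if a = b then 1 else 0)
    {K : S ⊕ O → S ⊕ O → ℝ} {κ L lam : ℝ} (hL : 0 ≤ L)
    (hKS : ∀ s s', K (Sum.inl s) (Sum.inl s') = κ)
    (hK1 : ∀ o j, |K (Sum.inr o) j| ≤ L) (hK2 : ∀ s o, |K (Sum.inl s) (Sum.inr o)| ≤ L)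
    (hκ : N ^ 2 * L ≤ κ)
    (hlam : lam = 1 / 2 * ∑ i, ∑ j,
      if i = j ∨ (i.isLeft = true ∧ j.isLeft = true) then 0 else K i j) :
    lam ≤ ∑ a : Fin N, ∑ b : Fin N, if (a : ℕ) < m ∧ a < b then
      1 / 2 * ∑ i, ∑ j, K i j * (X a i * X b j - X a j * X b i) ^ 2 else 0 := by
  have hN' : N = Fintype.card (S ⊕ O) := by rw [Fintype.card_sum, hN]
  have hmN : m ≤ N := by omega
  set p : S ⊕ O → ℝ := fun i => frameProj m X i i with hp
  set δ : ℝ := ∑ s, p (Sum.inl s) with hδ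
  have hp0 : ∀ i, 0 ≤ p i := fun i => frameProj_self_nonneg i
  have hp1 : ∀ i, p i ≤ 1 := fun i => frameProj_self_le_one hX i
  have hδ0 : 0 ≤ δ := Finset.sum_nonneg fun s _ => hp0 _
  -- The projection has trace `m`, the number of indices in `O`: what is missing there reappears on
  -- `S`.
  have hδO : ∑ o, (1 - p (Sum.inr o)) = δ := by
    have h := sum_frameProj_self hmN hX
    rw [Fintype.sum_sum_type] at h
    rw [Finset.sum_sub_distrib, Finset.sum_const, Finset.card_univ, nsmul_eq_mul, mul_one, ← hm,
      ← h]
    ring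
  have hO : ∀ o, 1 - p (Sum.inr o) ≤ δ := fun o => by
    rw [← hδO]
    exact Finset.single_le_sum (f := fun o => 1 - p (Sum.inr o))
      (fun o _ => sub_nonneg.2 (hp1 _)) (Finset.mem_univ o)
  -- With p the diagonal and Π the matrix of the projection, 1 - minor = (1 - p_o)(1 - p_j) - Π_oj²,
  -- and Π_oj² ≤ p_o (1 - p_o); both terms are at most 1 - p_o ≤ δ.
  have hM : ∀ (o : O) (j : S ⊕ O), Sum.inr o ≠ j →
      |frameMinor m X (Sum.inr o) j - 1| ≤ δ := by
    intro o j hj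
    rw [frameMinor_eq hN' hX hj]
    have h1 := frameProj_sq_add_sq_le (m := m) hX hj
    have h2 := hO o
    have h3 := hp0 (Sum.inr o)
    have h4 := hp1 (Sum.inr o)
    have h5 := hp0 j
    have h6 := hp1 j
    simp only [hp] at h2 h3 h4 h5 h6
    rw [abs_le]
    constructor <;> nlinarith [mul_nonneg (sub_nonneg.2 h4) h5,
      sq_nonneg (frameProj m X (Sum.inr o) j),
      mul_nonneg (sub_nonneg.2 h4) (sub_nonneg.2 h6), mul_nonneg (sub_nonneg.2 h4) h3]
  have hMc : ∀ i j, frameMinor m X i j = frameMinor m X j i := by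
    intro i j
    by_cases hij : i = j
    · rw [hij]
    · rw [frameMinor_eq hN' hX hij, frameMinor_eq hN' hX (Ne.symm hij), frameProj_comm i j]
      ring
  have hT : (∑ a : Fin N, ∑ b : Fin N, if (a : ℕ) < m ∧ a < b then
      1 / 2 * ∑ i, ∑ j, K i j * (X a i * X b j - X a j * X b i) ^ 2 else 0) =
      1 / 2 * ∑ i, ∑ j, K i j * frameMinor m X i j := by
    have : ∀ a b : Fin N, (if (a : ℕ) < m ∧ a < b then
      1 / 2 * ∑ i, ∑ j, K i j * (X a i * X b j - X a j * X b i) ^ 2 else 0) =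
      1 / 2 * ∑ i, ∑ j, K i j *
        (if (a : ℕ) < m ∧ a < b then (X a i * X b j - X a j * X b i) ^ 2 else 0) := by
      intro a b; split_ifs <;> simp
    simp only [this]
    simp only [frameMinor, Finset.mul_sum]
    exact sum_sum_sum_sum_comm _
  rw [hT, hlam, ← sub_nonneg, ← mul_sub, ← Finset.sum_sub_distrib]
  simp only [← Finset.sum_sub_distrib]
  -- Two distinct indices of `S` gain at least κ p_i, since their minor is at least p_i; all other
  -- pairs lose at most L δ.
  have hterm : ∀ i j, (if i.isLeft = true ∧ j.isLeft = true ∧ i ≠ j then κ * p i else 0) - L * δ ≤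
      K i j * frameMinor m X i j -
        (if i = j ∨ (i.isLeft = true ∧ j.isLeft = true) then 0 else K i j) := by
    intro i j
    have hLδ := mul_nonneg hL hδ0
    have hκ0 : 0 ≤ κ := le_trans (by positivity) hκ
    by_cases hij : i = j
    · simp [hij, frameMinor_self]
      exact hLδ
    have hrest : ∀ k M : ℝ, |k| ≤ L → |M - 1| ≤ δ → -(L * δ) ≤ k * M - k := by
      intro k M hk hM
      have : |k * (M - 1)| ≤ L * δ := by
        rw [abs_mul]; exact mul_le_mul hk hM (abs_nonneg _) hL
      have := (abs_le.1 this).1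
      linarith
    rcases i with s | o
    · rcases j with s' | o'
      · simp only [hKS, hij, Sum.isLeft_inl, and_self, or_true, if_true, ne_eq, not_false_eq_true]
        have h : p (Sum.inl s) ≤ frameMinor m X (Sum.inl s) (Sum.inl s') := by
          rw [frameMinor_eq hN' hX hij]
          have h3 := hp0 (Sum.inl s')
          have h4 := hp1 (Sum.inl s)
          simp only [hp] at h3 h4 ⊢
          nlinarith [sq_nonneg (frameProj m X (Sum.inl s) (Sum.inl s')),
            mul_nonneg (sub_nonneg.2 h4) h3]
        nlinarith [mul_le_mul_of_nonneg_left h hκ0]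
      · simp only [reduceCtorEq, Sum.isLeft_inr, Bool.false_eq_true, and_false, false_and, or_self,
          if_false, zero_sub]
        rw [hMc]
        exact hrest _ _ (hK2 s o') (hM o' _ (by simp))
    · simp only [hij, Sum.isLeft_inr, Bool.false_eq_true, false_and, or_self, if_false, zero_sub]
      exact hrest _ _ (hK1 o j) (hM o j hij)
  refine mul_nonneg (by norm_num) (le_trans ?_
    (Finset.sum_le_sum fun i _ => Finset.sum_le_sum fun j _ => hterm i j))
  simp only [Finset.sum_sub_distrib, Finset.sum_const, Finset.card_univ, nsmul_eq_mul, ← hN']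
  rw [Fintype.sum_sum_type]
  simp only [Fintype.sum_sum_type, Sum.isLeft_inl, Sum.isLeft_inr, Bool.false_eq_true, false_and,
    if_false, Finset.sum_const_zero, add_zero, true_and, ne_eq, Sum.inl.injEq]
  have hsum : ∀ s : S, ∑ s' : S, (if ¬ s = s' then κ * p (Sum.inl s) else 0) =
      (Fintype.card S - 1) * (κ * p (Sum.inl s)) := by
    intro s
    rw [← Finset.sum_filter, Finset.sum_const, nsmul_eq_mul, Finset.filter_ne,
      Finset.card_erase_of_mem (Finset.mem_univ _), Finset.card_univ,
      Nat.cast_sub (by omega)]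
    simp
  simp only [hsum, ← Finset.mul_sum]
  rw [← hδ]
  have hS' : (2 : ℝ) ≤ Fintype.card S := by exact_mod_cast hS
  have hκ0 : 0 ≤ κ := le_trans (by positivity) hκ
  -- The gain (|S| - 1) κ δ ≥ κ δ covers the total loss N² L δ; this is where two sphere dimensions
  -- are needed.
  nlinarith [mul_nonneg (mul_nonneg hκ0 hδ0) (by linarith : (0:ℝ) ≤ Fintype.card S - 2),
    mul_le_mul_of_nonneg_right hκ hδ0]

end FrameAlgebra

/-! ### The differential equation for the warping exponent -/

section WarpingFunctions

/-- A nonnegative solution `S` of the second order equation `D S'' + e S'² = lam` that governs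
the intermediate curvature of the metrics with warping functions `exp (-S)` and
`exp (2 S / l)`, with `S'²` dominated by `C exp (2 S)`. -/
structure IsWarpingExponent (D e lam C : ℝ) (S s s' : ℝ → ℝ) : Prop where
  contDiff : ContDiff ℝ ∞ S
  nonneg : ∀ r, 0 ≤ S r
  hasDerivAt : ∀ r, HasDerivAt S (s r) r
  hasDerivAt_deriv : ∀ r, HasDerivAt s (s' r) r
  ode : ∀ r, D * s' r + e * s r ^ 2 = lam
  deriv2_nonneg : ∀ r, 0 ≤ s' r
  deriv2_le : ∀ r, s' r ≤ lam / D
  sq_le : ∀ r, s r ^ 2 ≤ C * Real.exp (2 * S r)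

theorem isWarpingExponent_gaussian {D lam : ℝ} (hD : 0 < D) (hlam : 0 < lam) :
    IsWarpingExponent D 0 lam (lam / D) (fun r => lam * r ^ 2 / (2 * D)) (fun r => lam * r / D)
      (fun _ => lam / D) where
  contDiff := by fun_prop
  nonneg r := by positivity
  hasDerivAt r := by
    have h := ((hasDerivAt_pow 2 r).const_mul lam).div_const (2 * D)
    refine h.congr_deriv ?_
    field_simp
    norm_num
  hasDerivAt_deriv r := by
    simpa using ((hasDerivAt_id r).const_mul lam).div_const D
  ode r := by field_simp; ring
  deriv2_nonneg r := by positivity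
  deriv2_le r := le_rfl
  sq_le r := by
    -- Here s² = (λ / D) · 2S, so t ≤ exp t at t = 2S is enough.
    have h := Real.add_one_le_exp (2 * (lam * r ^ 2 / (2 * D)))
    have h2 : 2 * (lam * r ^ 2 / (2 * D)) ≤ Real.exp (2 * (lam * r ^ 2 / (2 * D))) := by linarith
    calc (lam * r / D) ^ 2 = lam / D * (2 * (lam * r ^ 2 / (2 * D))) := by field_simp
      _ ≤ _ := mul_le_mul_of_nonneg_left h2 (by positivity)

/-- The substitution y = exp(c D S) linearises the equation to y'' = c λ y, and y = cosh is the even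
solution with y(0) = 1. Then s is a multiple of tanh, hence bounded. -/
theorem isWarpingExponent_cosh {D c lam : ℝ} (hD : 0 < D) (hc : 0 < c) (hlam : 0 < lam) :
    IsWarpingExponent D (c * D ^ 2) lam (lam / (c * D ^ 2))
      (fun r => Real.log (Real.cosh (√(c * lam) * r)) / (D * c))
      (fun r => √(c * lam) * Real.sinh (√(c * lam) * r) / Real.cosh (√(c * lam) * r) / (D * c))
      (fun r => lam / (D * Real.cosh (√(c * lam) * r) ^ 2)) := by
  have hκ : √(c * lam) ^ 2 = c * lam := Real.sq_sqrt (by positivity)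
  set κ := √(c * lam) with hκdef
  have hlin : ∀ r, HasDerivAt (fun r => κ * r) κ r := fun r => by
    simpa using (hasDerivAt_id r).const_mul κ
  have hC := fun r : ℝ => Real.cosh_pos (κ * r)
  have hcs := fun r : ℝ => Real.cosh_sq (κ * r)
  have hCs : ContDiff ℝ ∞ fun r : ℝ => Real.cosh (κ * r) :=
    Real.contDiff_cosh.comp (contDiff_const.mul contDiff_id)
  have hexp1 : ∀ r, 1 ≤ Real.exp (2 * (Real.log (Real.cosh (κ * r)) / (D * c))) := fun r =>
    Real.one_le_exp (mul_nonneg zero_le_two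
      (div_nonneg (Real.log_nonneg (Real.one_le_cosh _)) (by positivity)))
  constructor
  · exact (hCs.log fun r => (hC r).ne').div_const _
  · intro r
    exact div_nonneg (Real.log_nonneg (Real.one_le_cosh _)) (by positivity)
  · intro r
    have h := ((hlin r).cosh.log (hC r).ne').div_const (D * c)
    refine h.congr_deriv ?_
    ring
  · intro r
    have h := (((hlin r).sinh.const_mul κ).div (hlin r).cosh (hC r).ne').div_const (D * c)
    refine h.congr_deriv ?_
    have h1 := (hC r).ne'
    have h2 := hcs r
    field_simp
    have : lam * c = κ ^ 2 * (Real.cosh (κ * r) ^ 2 - Real.sinh (κ * r) ^ 2) := by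
      rw [hκ, h2]; ring
    linarith
  · intro r
    have h1 := (hC r).ne'
    have h2 := hcs r
    have : c * D ^ 2 * (κ * Real.sinh (κ * r) / Real.cosh (κ * r) / (D * c)) ^ 2 =
        κ ^ 2 * Real.sinh (κ * r) ^ 2 / (c * Real.cosh (κ * r) ^ 2) := by
      field_simp
    rw [this, hκ]
    field_simp
    rw [h2]
    ring
  · intro r
    have h1 := hC r
    positivity
  · intro r
    have h1 : 1 ≤ Real.cosh (κ * r) ^ 2 := one_le_pow₀ (Real.one_le_cosh _)
    exact div_le_div_of_nonneg_left hlam.le hD (le_mul_of_one_le_right hD.le h1)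
  · intro r
    have h1 := hC r
    have h2 := hcs r
    calc _ = κ ^ 2 * Real.sinh (κ * r) ^ 2 / (Real.cosh (κ * r) ^ 2 * (c ^ 2 * D ^ 2)) := by
          field_simp
      _ = lam / (c * D ^ 2) * (Real.sinh (κ * r) ^ 2 / Real.cosh (κ * r) ^ 2) := by
          rw [hκ]; field_simp
      _ ≤ lam / (c * D ^ 2) * Real.exp (2 * (Real.log (Real.cosh (κ * r)) / (D * c))) := by
          refine mul_le_mul_of_nonneg_left (le_trans ?_ (hexp1 r)) (by positivity)
          rw [div_le_one (by positivity), h2]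
          linarith

theorem exists_isWarpingExponent {n m : ℕ} (hn7 : n ≤ 7) (hn6 : 6 ≤ n) (hm : 2 ≤ m)
    (hmn : m + 3 ≤ n) {lam : ℝ} (hlam : 0 < lam) :
    ∃ (C : ℝ) (S s s' : ℝ → ℝ), 0 ≤ C ∧
      IsWarpingExponent ((n : ℝ) - m - 2) ((n : ℝ) - m - 2 * m / (m - 1)) lam C S s s' ∧
      (∀ r, warpF n m lam r = Real.exp (-S r)) ∧
      ∀ r, warpU n m lam r = Real.exp (m * S r / (m - 1)) := by
  have hm' : (2 : ℝ) ≤ m := by exact_mod_cast hm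
  have hmn' : (m : ℝ) + 3 ≤ n := by exact_mod_cast hmn
  have hD : (0 : ℝ) < (n : ℝ) - m - 2 := by linarith
  have hm1 : (0 : ℝ) < (m : ℝ) - 1 := by linarith
  have hm0 : (0 : ℝ) < (m : ℝ) := by linarith
  have hk : (0 : ℝ) < (n : ℝ) - m := by linarith
  -- Multiplied by m - 1 this reads m² - mn + m + n ≤ 0, the failure of the inequality; equality is
  -- the Gaussian case.
  have he : 0 ≤ (n : ℝ) - m - 2 * m / (m - 1) := by
    have hm4 : m ≤ 4 := by omega
    interval_cases m <;> interval_cases n <;> first | omega | norm_num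
  by_cases h : 4 / ((n : ℝ) - m) = (2 * m - 2) / m
  · have he0 : (n : ℝ) - m - 2 * m / (m - 1) = 0 := by
      rw [div_eq_div_iff hk.ne' hm0.ne'] at h
      field_simp
      linarith
    rw [he0]
    refine ⟨_, _, _, _, by positivity, isWarpingExponent_gaussian hD hlam, fun r => ?_, fun r => ?_⟩
    · rw [warpF, if_pos h]
    · rw [warpU, if_pos h]
      congr 1
      have : (2 * (m : ℝ) - 2) = 2 * (m - 1) := by ring
      rw [this]
      field_simp
  · have he0 : (n : ℝ) - m - 2 * m / (m - 1) ≠ 0 := by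
      intro h0
      apply h
      rw [div_eq_div_iff hk.ne' hm0.ne']
      field_simp at h0
      linarith
    have hc : 0 < constC₄ n m := div_pos (lt_of_le_of_ne he he0.symm) (by positivity)
    have hce : (n : ℝ) - m - 2 * m / (m - 1) = constC₄ n m * ((n : ℝ) - m - 2) ^ 2 := by
      rw [constC₄, div_mul_cancel₀ _ (by positivity)]
    rw [hce]
    refine ⟨_, _, _, _, by positivity, isWarpingExponent_cosh hD hc hlam, fun r => ?_, fun r => ?_⟩
    -- Since C₃ - 1 = -(n - m) / (n - m - 2), the exponent of cosh in f is -1 / ((n - m - 2) C₄).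
    · rw [warpF, if_neg h, Real.rpow_def_of_pos (Real.cosh_pos _), constC₃]
      congr 1
      field_simp
      ring
    · rw [warpU, if_neg h, Real.rpow_def_of_pos (Real.cosh_pos _), constC₃]
      congr 1
      have : (2 * (m : ℝ) - 2) = 2 * (m - 1) := by ring
      rw [this]
      field_simp

end WarpingFunctions

/-! ### Block-constant curvature operators -/

section DiagonalCurvature

/-- A symmetric matrix indexed by `A ⊕ (B ⊕ Unit)`, constant on blocks. -/
def blockMatrix {A B : Type*} (κ c₁ c₂ c₃ c₄ : ℝ) : A ⊕ (B ⊕ Unit) → A ⊕ (B ⊕ Unit) → ℝ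
  | Sum.inl _, Sum.inl _ => κ
  | Sum.inl _, Sum.inr (Sum.inl _) => c₁
  | Sum.inl _, Sum.inr (Sum.inr _) => c₂
  | Sum.inr (Sum.inl _), Sum.inl _ => c₁
  | Sum.inr (Sum.inl _), Sum.inr (Sum.inl _) => c₃
  | Sum.inr (Sum.inl _), Sum.inr (Sum.inr _) => c₄
  | Sum.inr (Sum.inr _), Sum.inl _ => c₂
  | Sum.inr (Sum.inr _), Sum.inr (Sum.inl _) => c₄
  -- The line spans no plane, so this value never counts; 0 satisfies any bound by a nonnegative
  -- `L`.
  | Sum.inr (Sum.inr _), Sum.inr (Sum.inr _) => 0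

theorem sum_sum_minor_sq {A B : Type*} [Fintype A] [Fintype B] (c : ℝ) (x y : A → ℝ)
    (x' y' : B → ℝ) :
    ∑ a, ∑ b, c * (x a * y' b - x' b * y a) ^ 2 =
      c * ((∑ a, x a * x a) * (∑ b, y' b * y' b) + (∑ a, y a * y a) * (∑ b, x' b * x' b)
        - 2 * ((∑ a, x a * y a) * (∑ b, x' b * y' b))) := by
  rw [Finset.sum_mul_sum, Finset.sum_mul_sum, Finset.sum_mul_sum]
  simp only [Finset.mul_sum, ← Finset.sum_add_distrib, ← Finset.sum_sub_distrib]
  exact Finset.sum_congr rfl fun a _ => Finset.sum_congr rfl fun b _ => by ring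

/-- Lagrange's identity turns sums of squared minors into Gram expressions; the factor 1/2 corrects
for ordered pairs. -/
theorem half_sum_blockMatrix_mul_minor_sq {A B : Type*} [Fintype A] [Fintype B]
    (κ c₁ c₂ c₃ c₄ : ℝ) (x y : A → ℝ) (x' y' : B → ℝ) (r t : ℝ) :
    1 / 2 * ∑ i, ∑ j, blockMatrix κ c₁ c₂ c₃ c₄ i j *
      (Sum.elim x (Sum.elim x' fun _ : Unit => r) i * Sum.elim y (Sum.elim y' fun _ : Unit => t) j
        - Sum.elim x (Sum.elim x' fun _ : Unit => r) j *
          Sum.elim y (Sum.elim y' fun _ : Unit => t) i) ^ 2 =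
      κ * ((∑ a, x a * x a) * (∑ a, y a * y a) - (∑ a, x a * y a) ^ 2)
      + c₁ * ((∑ a, x a * x a) * (∑ b, y' b * y' b) + (∑ a, y a * y a) * (∑ b, x' b * x' b)
        - 2 * ((∑ a, x a * y a) * (∑ b, x' b * y' b)))
      + c₂ * ((∑ a, x a * x a) * t ^ 2 + (∑ a, y a * y a) * r ^ 2
        - 2 * ((∑ a, x a * y a) * (r * t)))
      + c₃ * ((∑ b, x' b * x' b) * (∑ b, y' b * y' b) - (∑ b, x' b * y' b) ^ 2)
      + c₄ * ((∑ b, x' b * x' b) * t ^ 2 + (∑ b, y' b * y' b) * r ^ 2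
        - 2 * ((∑ b, x' b * y' b) * (r * t))) := by
  simp only [Fintype.sum_sum_type, blockMatrix, Sum.elim_inl, Sum.elim_inr,
    Finset.sum_add_distrib]
  simp only [sum_sum_minor_sq]
  simp only [Finset.univ_unique, Finset.sum_singleton]
  ring

/-- A count of the coordinate planes not contained in the first block, which is the curvature sum of
the frame tangent to the torus and the line. -/
theorem half_sum_blockMatrix_offDiagonal {A B : Type*} [Fintype A] [Fintype B] [DecidableEq A]
    [DecidableEq B] (κ c₁ c₂ c₃ c₄ : ℝ) :
    (1 / 2 * ∑ i : A ⊕ (B ⊕ Unit), ∑ j : A ⊕ (B ⊕ Unit),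
      if i = j ∨ (i.isLeft = true ∧ j.isLeft = true) then 0 else
        blockMatrix κ c₁ c₂ c₃ c₄ i j : ℝ) =
      Fintype.card A * Fintype.card B * c₁ + Fintype.card A * c₂
        + Fintype.card B * (Fintype.card B - 1) / 2 * c₃ + Fintype.card B * c₄ := by
  have h : ∀ b : B, ∑ b' : B, (if b = b' then 0 else c₃) = (Fintype.card B - 1) * c₃ := by
    intro b
    have : ∀ b' : B, (if b = b' then 0 else c₃) = c₃ - if b = b' then c₃ else 0 := fun b' => by
      split_ifs <;> ring
    simp only [this, Finset.sum_sub_distrib, Finset.sum_ite_eq, Finset.mem_univ, if_true,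
      Finset.sum_const, Finset.card_univ, nsmul_eq_mul]
    ring
  simp only [Fintype.sum_sum_type, blockMatrix, Sum.isLeft_inl, Sum.isLeft_inr, reduceCtorEq,
    Sum.inl.injEq, Sum.inr.injEq, and_self, or_true, if_true, Bool.false_eq_true, and_false,
    false_and, or_self, or_false, if_false, h, Finset.sum_const, Finset.card_univ, nsmul_eq_mul,
    Finset.sum_add_distrib, Fintype.card_unit, Nat.cast_one]
  ring

end DiagonalCurvature

/-! ### Coordinates orthonormal at the centre of the chart -/

section OrthonormalCoordinates

variable {k l : ℕ}

/-- Coordinates on the model space, scaled by `α` on the sphere and by `β` on the torus. -/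
def scaledCoord (α β : ℝ) (v : ModelSpaceSTL k l) : Fin k ⊕ (Fin l ⊕ Unit) → ℝ :=
  Sum.elim (fun i => α * v.1 i) (Sum.elim (fun i => β * v.2.1 i 0) fun _ => v.2.2)

theorem sum_mul_coord_sphere (α : ℝ) (v w : EuclideanSpace ℝ (Fin k)) :
    ∑ i, α * v i * (α * w i) = α ^ 2 * inner ℝ v w := by
  rw [PiLp.inner_apply, Finset.mul_sum]
  exact Finset.sum_congr rfl fun i _ => by simp; ring

theorem sum_mul_coord_circle (β : ℝ) (v w : ModelSpaceSTL k l) :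
    ∑ i, β * v.2.1 i 0 * (β * w.2.1 i 0) = β ^ 2 * circleInner v w := by
  rw [circleInner, Finset.mul_sum]
  exact Finset.sum_congr rfl fun i _ => by simp [PiLp.inner_apply]; ring

theorem sum_scaledCoord_mul {α β : ℝ} {P Q : ℝ → ℝ} {y : ModelSpaceSTL k l} (hy1 : y.1 = 0)
    (hy2 : ∀ i, y.2.1 i = 0) (hα : α ^ 2 = P y.2.2) (hβ : β ^ 2 = Q y.2.2)
    (v w : ModelSpaceSTL k l) :
    ∑ j, scaledCoord α β v j * scaledCoord α β w j = stereoMetric k l P Q y v w := by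
  rw [stereoMetric_center hy1 hy2, ← hα, ← hβ, ← sum_mul_coord_sphere, ← sum_mul_coord_circle]
  simp only [scaledCoord, Fintype.sum_sum_type, Sum.elim_inl, Sum.elim_inr, Finset.univ_unique,
    Finset.sum_singleton]
  ring

theorem scaledCoord_surjective {α β : ℝ} (hα : α ≠ 0) (hβ : β ≠ 0)
    (X : Fin k ⊕ (Fin l ⊕ Unit) → ℝ) : ∃ v : ModelSpaceSTL k l, scaledCoord α β v = X := by
  refine ⟨(WithLp.toLp 2 fun i => X (Sum.inl i) / α,
    (fun i => WithLp.toLp 2 fun _ => X (Sum.inr (Sum.inl i)) / β, X (Sum.inr (Sum.inr ())))), ?_⟩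
  funext j
  rcases j with i | i | i
  · simp [scaledCoord, mul_div_cancel₀ _ hα]
  · simp [scaledCoord, mul_div_cancel₀ _ hβ]
  · rfl

theorem stereoMetric_curvatureInChart_eq_sum {P Q a b a' b' : ℝ → ℝ}
    {g : SmoothMetric (modelSTL k l) (SphereTorusLine k l)}
    {p : SphereTorusLine k l} (hg : g.inChart p = stereoMetric k l P Q)
    (hP0 : ∀ r, 0 < P r) (hQ0 : ∀ r, 0 < Q r)
    (hP : ∀ r, HasDerivAt P (2 * a r * P r) r) (hQ : ∀ r, HasDerivAt Q (2 * b r * Q r) r)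
    (ha : ∀ r, HasDerivAt a (a' r) r) (hb : ∀ r, HasDerivAt b (b' r) r)
    {y : ModelSpaceSTL k l} (hy1 : y.1 = 0) (hy2 : ∀ i, y.2.1 i = 0) {α β : ℝ}
    (hα : α ^ 2 = P y.2.2) (hβ : β ^ 2 = Q y.2.2) (v w : ModelSpaceSTL k l) :
    stereoMetric k l P Q y (g.curvatureInChart p y v w w) v =
      1 / 2 * ∑ i, ∑ j, blockMatrix (1 / P y.2.2 - a y.2.2 ^ 2) (-(a y.2.2 * b y.2.2))
        (-(a' y.2.2 + a y.2.2 ^ 2)) (-(b y.2.2 ^ 2)) (-(b' y.2.2 + b y.2.2 ^ 2)) i j *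
        (scaledCoord α β v i * scaledCoord α β w j
          - scaledCoord α β v j * scaledCoord α β w i) ^ 2 := by
  rw [stereoMetric_curvatureInChart hg hP0 hQ0 hP hQ ha hb hy1 hy2]
  unfold scaledCoord
  rw [half_sum_blockMatrix_mul_minor_sq]
  simp only [sum_mul_coord_sphere, sum_mul_coord_circle, hα, hβ]
  ring

end OrthonormalCoordinates

/-! ### Lower bound for the intermediate curvature -/

section MainTheorem

variable {k l m : ℕ}

theorem SmoothMetric.Rm_eq_curvatureInChart {g : SmoothMetric (modelSTL k l) (SphereTorusLine k l)}
    {p : SphereTorusLine k l} {P Q : ℝ → ℝ} (hg : g.inChart p = stereoMetric k l P Q)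
    (v w : ModelSpaceSTL k l) :
    g.Rm p v w = stereoMetric k l P Q (extChartAt (modelSTL k l) p p)
      (g.curvatureInChart p (extChartAt (modelSTL k l) p p) v w w) v := by
  have : IsManifold (modelSTL k l) 1 (SphereTorusLine k l) :=
    IsManifold.of_le (n := ∞) (by norm_cast)
  rw [← hg]
  unfold SmoothMetric.Rm
  rw [mfderiv_extChartAt_self]
  rfl

/-- The infimum defining the intermediate curvature must run over a nonempty set, as `sInf ∅ = 0`
would spoil a positive lower bound. -/
theorem exists_isOrthonormalFrame {g : SmoothMetric (modelSTL k l) (SphereTorusLine k l)}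
    {p : SphereTorusLine k l} {α β : ℝ} (hα : α ≠ 0) (hβ : β ≠ 0)
    (hg : ∀ v w : ModelSpaceSTL k l,
      g.inner p v w = ∑ j, scaledCoord α β v j * scaledCoord α β w j) :
    ∃ e, g.IsOrthonormalFrame p e := by
  have hcard : Fintype.card (Fin (Module.finrank ℝ (ModelSpaceSTL k l))) =
      Fintype.card (Fin k ⊕ (Fin l ⊕ Unit)) := by
    rw [Fintype.card_fin, finrank_modelSpaceSTL]; simp
  let σ := Fintype.equivOfCardEq hcard
  choose e he using fun i => scaledCoord_surjective (k := k) (l := l) hα hβ (Pi.single (σ i) 1)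
  refine ⟨e, fun i j => (hg _ _).trans ?_⟩
  simp only [he, Pi.single_apply]
  simp [σ.injective.eq_iff, eq_comm]

/-- `le_sum_frame_of_diagonal` applies with the sphere directions as `S` and the l + 1 torus and
line directions as `O`. -/
theorem le_intermediateCurvature_of_diagonal
    {g : SmoothMetric (modelSTL k l) (SphereTorusLine k l)} {p : SphereTorusLine k l}
    {P Q a b a' b' : ℝ → ℝ} (hg : g.inChart p = stereoMetric k l P Q)
    (hgp : ∀ v w : ModelSpaceSTL k l,
      g.inner p v w = stereoMetric k l P Q (extChartAt (modelSTL k l) p p) v w)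
    (hP0 : ∀ r, 0 < P r) (hQ0 : ∀ r, 0 < Q r)
    (hP : ∀ r, HasDerivAt P (2 * a r * P r) r) (hQ : ∀ r, HasDerivAt Q (2 * b r * Q r) r)
    (ha : ∀ r, HasDerivAt a (a' r) r) (hb : ∀ r, HasDerivAt b (b' r) r) {L lam : ℝ}
    (hk : 2 ≤ k) (hL : 0 ≤ L) (h₁ : |a p.2.2 * b p.2.2| ≤ L) (h₂ : |a' p.2.2 + a p.2.2 ^ 2| ≤ L)
    (h₃ : |b p.2.2 ^ 2| ≤ L) (h₄ : |b' p.2.2 + b p.2.2 ^ 2| ≤ L)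
    (hκ : ((k + (l + 1) : ℕ) : ℝ) ^ 2 * L ≤ 1 / P p.2.2 - a p.2.2 ^ 2)
    (hlam : lam = k * l * -(a p.2.2 * b p.2.2) + k * -(a' p.2.2 + a p.2.2 ^ 2)
      + l * (l - 1) / 2 * -(b p.2.2 ^ 2) + l * -(b' p.2.2 + b p.2.2 ^ 2)) :
    lam ≤ g.intermediateCurvature (l + 1) p := by
  set y : ModelSpaceSTL k l := extChartAt (modelSTL k l) p p with hy
  have hy1 : y.1 = 0 := (extChartAt_modelSTL_self_fst p).trans (stereographic'_neg_self _)
  have hy2 : ∀ i, y.2.1 i = 0 := fun i =>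
    (extChartAt_modelSTL_self_circle p i).trans (stereographic'_neg_self _)
  have hα := Real.sq_sqrt (hP0 y.2.2).le
  have hβ := Real.sq_sqrt (hQ0 y.2.2).le
  have hinner : ∀ v w : ModelSpaceSTL k l, g.inner p v w =
      ∑ j, scaledCoord (√(P y.2.2)) (√(Q y.2.2)) v j *
        scaledCoord (√(P y.2.2)) (√(Q y.2.2)) w j := fun v w => by
    rw [hgp, sum_scaledCoord_mul hy1 hy2 hα hβ]
  obtain ⟨e₀, he₀⟩ := exists_isOrthonormalFrame (Real.sqrt_pos.2 (hP0 y.2.2)).ne'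
    (Real.sqrt_pos.2 (hQ0 y.2.2)).ne' hinner
  refine le_csInf ⟨_, e₀, he₀, rfl⟩ ?_
  rintro _ ⟨e, he, rfl⟩
  have hRm : ∀ i j, g.Rm p (e i) (e j) = _ := fun i j =>
    (SmoothMetric.Rm_eq_curvatureInChart hg (e i) (e j)).trans
      (stereoMetric_curvatureInChart_eq_sum hg hP0 hQ0 hP hQ ha hb hy1 hy2 hα hβ (e i) (e j))
  unfold SmoothMetric.frameIntermediateCurvature
  simp only [hRm]
  have hN := finrank_modelSpaceSTL (k := k) (l := l)
  refine le_sum_frame_of_diagonal (L := L) (hN.trans (by simp)) (by simp) (by simpa using hk)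
    (X := fun i => scaledCoord (√(P y.2.2)) (√(Q y.2.2)) (e i))
    (fun i j => (hinner _ _).symm.trans (he i j)) hL (fun s s' => rfl) ?_ ?_
    (le_of_eq_of_le (by rw [hN]) hκ)
    (hlam.trans ((half_sum_blockMatrix_offDiagonal _ _ _ _ _).trans (by simp; rfl)).symm)
  · rintro (o | o) (j | j | j)
    · exact (abs_neg _).trans_le h₁
    · exact (abs_neg _).trans_le h₃
    · exact (abs_neg _).trans_le h₄
    · exact (abs_neg _).trans_le h₂
    · exact (abs_neg _).trans_le h₄
    · exact (abs_zero).trans_le hL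
  · rintro s (o | o)
    · exact (abs_neg _).trans_le h₁
    · exact (abs_neg _).trans_le h₂

theorem IsWarpingExponent.le_intermediateCurvature {lam C ε : ℝ} {S s s' : ℝ → ℝ}
    (hk : 3 ≤ k) (hl : 1 ≤ l)
    (hS : IsWarpingExponent ((k : ℝ) - 2) ((k : ℝ) - 2 * (l + 1) / l) lam C S s s')
    (hε : 0 < ε)
    (hsmall : ε ^ 2 * (((k + (l + 1) : ℕ) : ℝ) ^ 2 * (2 * (lam / (k - 2)) + 4 * C) + C) ≤ 1)
    {f u : ℝ → ℝ} (hfS : ∀ r, f r = Real.exp (-S r))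
    (huS : ∀ r, u r ^ (4 / ((l + 1 : ℕ) : ℝ)) = Real.exp (4 * S r / l))
    (hf : ∀ r, 0 < f r) (hu : ∀ r, 0 < u r) (hfs : ContDiff ℝ ∞ f) (hus : ContDiff ℝ ∞ u)
    (p : SphereTorusLine k l) :
    lam ≤ (warpedMetric k l (l + 1) hε.ne' hf hu hfs hus).intermediateCurvature (l + 1) p := by
  have hk' : (3 : ℝ) ≤ k := by exact_mod_cast hk
  have hl' : (1 : ℝ) ≤ l := by exact_mod_cast hl
  have hl0 : (0 : ℝ) < l := by linarith
  have hPe : (fun r => ε ^ 2 * f r ^ 2) = fun r => ε ^ 2 * Real.exp (-(2 * S r)) := by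
    funext r
    rw [hfS, ← Real.exp_nat_mul]
    congr 2
    push_cast
    ring
  have hQe : (fun r => u r ^ (4 / ((l + 1 : ℕ) : ℝ))) = fun r => Real.exp (4 * S r / l) :=
    funext huS
  set r := p.2.2 with hr
  have hs0 := sq_nonneg (s r)
  have hs'0 := hS.deriv2_nonneg r
  have hs1 : s r ^ 2 / l ≤ s r ^ 2 := div_le_self hs0 hl'
  have hs2 : s r ^ 2 / l ^ 2 ≤ s r ^ 2 := div_le_self hs0 (one_le_pow₀ hl')
  have hs3 : s' r / l ≤ s' r := div_le_self hs'0 hl'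
  have hs1' : 0 ≤ s r ^ 2 / l := by positivity
  have hs2' : 0 ≤ s r ^ 2 / l ^ 2 := by positivity
  have hs3' : 0 ≤ s' r / l := by positivity
  have e1 : -s r * (2 * s r / l) = -(2 * (s r ^ 2 / l)) := by ring
  have e3 : (2 * s r / l) ^ 2 = 4 * (s r ^ 2 / l ^ 2) := by ring
  have e4 : 2 * s' r / l = 2 * (s' r / l) := by ring
  -- `a` and `b` are the logarithmic derivatives of ε exp(-S) and exp(2S/l). The choice of `L` is
  -- dictated by the torus-line eigenvalue 2s'/l + 4s²/l², and covers the others too.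
  refine le_intermediateCurvature_of_diagonal (a := fun r => -s r) (a' := fun r => -s' r)
    (b := fun r => 2 * s r / l) (b' := fun r => 2 * s' r / l) (L := 2 * s' r + 4 * s r ^ 2)
    (warpedMetric_inChart _ _ _ _ _ p) (fun v w => rfl)
    (fun r => by have := hf r; positivity) (fun r => Real.rpow_pos_of_pos (hu r) _) ?_ ?_
    (fun r => (hS.hasDerivAt_deriv r).neg)
    (fun r => ((hS.hasDerivAt_deriv r).const_mul 2).div_const _) (by omega) (by positivity)
    ?_ ?_ ?_ ?_ ?_ ?_
  · rw [hPe]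
    intro r
    refine ((((hS.hasDerivAt r).const_mul 2).neg.exp).const_mul (ε ^ 2)).congr_deriv ?_
    have h := congrFun hPe r
    simp only [Pi.neg_apply] at h ⊢
    linear_combination 2 * s r * h
  · rw [hQe]
    intro r
    refine ((((hS.hasDerivAt r).const_mul 4).div_const _).exp).congr_deriv ?_
    rw [huS]
    ring
  · simp only [← hr]
    rw [e1, abs_le]
    constructor <;> linarith
  · simp only [← hr]
    rw [neg_sq, abs_le]
    constructor <;> linarith
  · simp only [← hr]
    rw [e3, abs_le]
    constructor <;> linarith
  · simp only [← hr]
    rw [e3, e4, abs_le]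
    constructor <;> linarith
  -- After multiplication by P = ε² exp(-2S) the claim is (N² L + s²) P ≤ 1; the factor exp(2S)
  -- bounding N² L + s² cancels, leaving a condition on ε free of r.
  · have hP := congrFun hPe r
    simp only [← hr] at hP ⊢
    rw [hP, neg_sq, le_sub_iff_add_le, le_div_iff₀ (by positivity)]
    have hE : 1 ≤ Real.exp (2 * S r) := Real.one_le_exp (by have := hS.nonneg r; linarith)
    have hsE := hS.sq_le r
    have hs'E : s' r ≤ lam / (k - 2) * Real.exp (2 * S r) :=
      (hS.deriv2_le r).trans (le_mul_of_one_le_right (hs'0.trans (hS.deriv2_le r)) hE)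
    have hN2 : (0 : ℝ) ≤ ((k + (l + 1) : ℕ) : ℝ) ^ 2 := sq_nonneg _
    have hbound : ((k + (l + 1) : ℕ) : ℝ) ^ 2 * (2 * s' r + 4 * s r ^ 2) + s r ^ 2 ≤
        (((k + (l + 1) : ℕ) : ℝ) ^ 2 * (2 * (lam / (k - 2)) + 4 * C) + C) *
          Real.exp (2 * S r) := by
      have := mul_le_mul_of_nonneg_left
        (by linarith : 2 * s' r + 4 * s r ^ 2 ≤
          (2 * (lam / (k - 2)) + 4 * C) * Real.exp (2 * S r)) hN2
      linarith
    calc _ ≤ _ := mul_le_mul_of_nonneg_right hbound (by positivity)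
      _ = ε ^ 2 * (((k + (l + 1) : ℕ) : ℝ) ^ 2 * (2 * (lam / (k - 2)) + 4 * C) + C) *
          (Real.exp (2 * S r) * Real.exp (-(2 * S r))) := by ring
      _ ≤ 1 := by rwa [← Real.exp_add, add_neg_cancel, Real.exp_zero, mul_one]
  -- With these `a` and `b` the curvature sum is exactly the left side of the differential equation.
  · have h := hS.ode r
    simp only [← hr]
    rw [← h]
    field_simp
    ring

end MainTheorem

end

theorem mainTheorem2 (n m : ℕ) (hn3 : 3 ≤ n) (hn7 : n ≤ 7) (hm1 : 1 ≤ m) (hmn : m + 1 ≤ n) :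
    (¬ ((m : ℤ) ^ 2 - m * n + m + n > 0) ↔ 6 ≤ n ∧ 2 ≤ m ∧ m + 3 ≤ n) ∧
    (6 ≤ n → 2 ≤ m → m + 3 ≤ n →
      ∀ lam : ℝ, 0 < lam → ∃ ε₀ : ℝ, 0 < ε₀ ∧ ∀ ε : ℝ, 0 < ε → ε < ε₀ →
        ∃ g : SmoothMetric (modelSTL (n - m) (m - 1)) (SphereTorusLine (n - m) (m - 1)),
          (∀ p v w, g.inner p v w =
            warpedForm (n - m) (m - 1) m ε (warpF n m lam) (warpU n m lam) p v w) ∧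
          g.IsComplete ∧
          ∀ p, lam ≤ g.intermediateCurvature m p) := by
  refine ⟨?_, fun hn6 hm2 hm3 lam hlam => ?_⟩
  · have hm6 : m ≤ 6 := by omega
    interval_cases m <;> interval_cases n <;> omega
  obtain ⟨C, S, s, s', hC, hS, hF, hU⟩ := exists_isWarpingExponent hn7 hn6 hm2 hm3 hlam
  obtain ⟨l, rfl⟩ : ∃ l, m = l + 1 := ⟨m - 1, by omega⟩
  have hl0 : (l : ℝ) ≠ 0 := by
    have : l ≠ 0 := by omega
    exact_mod_cast this
  have hml : ((l + 1 : ℕ) : ℝ) - 1 = l := by push_cast; ring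
  have hl1 : ((l + 1 : ℕ) : ℝ) ≠ 0 := by positivity
  rw [← Nat.cast_sub (show l + 1 ≤ n by omega), hml] at hS
  simp only [hml] at hU
  rw [Nat.add_sub_cancel]
  have hk : 3 ≤ n - (l + 1) := by omega
  have hk' : (3 : ℝ) ≤ ((n - (l + 1) : ℕ) : ℝ) := by exact_mod_cast hk
  set k := n - (l + 1) with hkdef
  have hD : (0 : ℝ) < (k : ℝ) - 2 := by linarith
  set A : ℝ := ((k + (l + 1) : ℕ) : ℝ) ^ 2 * (2 * (lam / (k - 2)) + 4 * C) + C with hA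
  have hA0 : 0 ≤ A := by positivity
  -- From ε (A + 1) < 1 follow ε < 1 and ε A < 1, hence ε² A ≤ 1.
  refine ⟨1 / (A + 1), by positivity, fun ε hε hε1 => ?_⟩
  have hsmall : ε ^ 2 * A ≤ 1 := by
    rw [lt_div_iff₀ (by positivity)] at hε1
    nlinarith [mul_nonneg hε.le hA0]
  have hf : ∀ r, 0 < warpF n (l + 1 : ℕ) lam r := fun r => by rw [hF]; exact Real.exp_pos _
  have hu : ∀ r, 0 < warpU n (l + 1 : ℕ) lam r := fun r => by rw [hU]; exact Real.exp_pos _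
  have hfs : ContDiff ℝ ∞ (warpF n (l + 1 : ℕ) lam) := by
    rw [funext hF]; exact hS.contDiff.neg.exp
  have hus : ContDiff ℝ ∞ (warpU n (l + 1 : ℕ) lam) := by
    rw [funext hU]; exact ((contDiff_const.mul hS.contDiff).div_const _).exp
  refine ⟨warpedMetric k l (l + 1) hε.ne' hf hu hfs hus,
    fun p v w => warpedMetric_inner _ _ _ _ _ _ _ _,
    warpedMetric_isComplete _ _ _ _ _, fun p => ?_⟩
  refine IsWarpingExponent.le_intermediateCurvature hk (by omega) (by simpa using hS) hε hsmall
    hF (fun r => ?_) hf hu hfs hus p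
  rw [hU, ← Real.exp_mul]
  congr 1
  field_simp
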